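/- Let $h>1$, $\tfrac{3\pi}{4}<\psi\le\pi$ and $0<\delta<\sqrt{h-1}$. Let $\kappa^{\psi}$ be the angular contour made of the ray $\arg s=-\psi$, $|s|\ge\delta$ (coming in from infinity), the arc $|s|=\delta$, $|\arg s|\le\psi$ (counterclockwise) and the ray $\arg s=\psi$, $|s|\ge\delta$ (going out to infinity); for $\psi=\pi$ the two rays are the two sides of a cut along the negative half-axis. Let $\kappa^{\psi}_r$ ($r>\delta$) be its part in $|s|\le r$, and let $D_\psi=\{z\ne0:|\arg z|<\psi-\tfrac{\pi}{2}\}$. Let $g\in\mathcal L_{>}(\mathbb R_+)$ with angle $\psi(g)=\psi$, that is: $g:(0,\infty)\to\mathbb C$ is real-analytic; $\mathcal L(g)(s)=\int_0^\infty e^{-ts}g(t)\,dt$ converges absolutely on some half-plane $\mathrm{Re}\,s>a$; and $\mathcal L(g)$ continues to a function that is analytic in the region $\{|s|>\delta,\ |\arg s|<\psi\}$ bounded by $\kappa^{\psi}$, and continuous and bounded on this region together with its boundary $\kappa^{\psi}$. The continuation is still denoted by $\mathcal L(g)$. For $\psi'\in\,]\tfrac{3\pi}{4},\psi]$ put $$f^{\psi'}_\infty(z)=\int_{\kappa^{\psi'}}e^{sz}\frac{\mathcal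 L(g)(s)}{\zeta(s^2+h)}\frac{ds}{2\pi i},\qquad g^{\psi'}_\infty(z)=\int_{\kappa^{\psi'}}e^{sz}\mathcal L(g)(s)\frac{ds}{2\pi i},$$ let $f^{\psi'}_r,g^{\psi'}_r$ be the same integrals over $\kappa^{\psi'}_r$, and let $\mathcal W(g)=\{f^{\psi'}_\infty:\tfrac{3\pi}{4}<\psi'\le\psi\}$. For a simply connected domain $\Omega$, $Exp(\Omega)$ is the space of entire functions $\phi(z)=\sum a_nz^n$ of exponential type whose Borel transform $\sum a_nn!/z^{n+1}$ continues analytically to a function $\mathcal B(\phi)$ on the complement of a compact subset of $\Omega$; for $f$ holomorphic on $\Omega$ one sets $f(\partial_t)\phi(z)=\frac1{2\pi i}\int_\gamma e^{sz}f(s)\mathcal B(\phi)(s)\,ds$, where $\gamma\subset\Omega$ is a simple closed rectifiable positively oriented curve enclosing the singularities of $\mathcal B(\phi)$. Let $\Omega_h=\mathbb C\setminus\{\mathrm{Re}\,s\ge0,\ |\mathrm{Im}\,s|=\sqrt{h-1}\}$ and $\Omega'_h=\{s\ne0:|\arg s|>\tfrac{3\pi}{4}\}\cup\{|s|<\sqrt{h-1}\}$.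 A function $G$ on $D_\psi$ is called a value of $\widetilde\zeta(\partial_t^2+h)$ at $f$ if there are $\phi_r\in Exp(\Omega'_h)$ with $\zeta(\partial_t^2+h)\phi_r=g^{\psi}_r$ for all $r>\delta$, such that, as $r\to\infty$, $\phi_r\to f$ and $\zeta(\partial_t^2+h)\phi_r\to G$ uniformly on compact subsets of $D_\psi$. Then: 1. The integrals defining $f^{\psi}_\infty$ and $g^{\psi}_\infty$ converge absolutely on $D_\psi$, and both functions are analytic there. 2. For every $r>\delta$, $f^{\psi}_r$ and $g^{\psi}_r$ belong to $Exp(\Omega_h)$ and to $Exp(\Omega'_h)$, and $\zeta(\partial_t^2+h)f^{\psi}_r=g^{\psi}_r$ in both spaces. As $r\to\infty$, $f^{\psi}_r\to f^{\psi}_\infty$ and $g^{\psi}_r\to g^{\psi}_\infty$ uniformly on compact subsets of $D_\psi$. 3. $f^{\psi}_\infty\in\mathcal W(g)$, and every $f^{\psi'}_\infty\in\mathcal W(g)$ coincides with $f^{\psi}_\infty$ on $D_{\psi'}$. 4. $f^{\psi}_\infty$ solves the reinterpreted equation $\widetilde\zeta(\partial_t^2+h)f=g$: the function $g^{\psi}_\infty$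 is a value of $\widetilde\zeta(\partial_t^2+h)$ at $f^{\psi}_\infty$, it is the only one on $D_\psi$, and $g^{\psi}_\infty(t)=g(t)$ for all $t>0$. Hence $\widetilde\zeta(\partial_t^2+h)f^{\psi}_\infty(t)=g(t)$ for all $t>0$. -/

import Mathlib

open Set Filter Topology MeasureTheory

noncomputable section

namespace ZetaNonlocal

/-! ### Entire functions of exponential type and functions of the derivative -/

/-- `B` is an analytic continuation, to the complement of the compact set `K`, of the Borel
transform `∑ aₙ n! / z ^ (n + 1)` of `φ = ∑ aₙ zⁿ`; recall that `aₙ n!` is the `n`-th derivative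
of `φ` at `0`.  The series is required to converge to `B` near `∞`. -/
structure IsBorelContinuation (φ : ℂ → ℂ) (K : Set ℂ) (B : ℂ → ℂ) : Prop where
  isCompact : IsCompact K
  differentiableOn : DifferentiableOn ℂ B Kᶜ
  hasSum : ∃ R : ℝ, ∀ z : ℂ, R < ‖z‖ →
    HasSum (fun n : ℕ => iteratedDeriv n φ 0 / z ^ (n + 1)) (B z)

/-- The space `Exp(Ω)`: entire functions of exponential type whose Borel transform continues
analytically to a neighbourhood of the complement of `Ω` in the Riemann sphere, i.e. to the
complement of a compact subset of `Ω`. -/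
structure MemExp (Ω : Set ℂ) (φ : ℂ → ℂ) : Prop where
  entire : Differentiable ℂ φ
  expType : ∃ C τ : ℝ, ∀ z : ℂ, ‖φ z‖ ≤ C * Real.exp (τ * ‖z‖)
  borel : ∃ (K : Set ℂ) (B : ℂ → ℂ), K ⊆ Ω ∧ IsBorelContinuation φ K B

/-- The integral of `k` along a curve parametrised by `[0, 1]`. -/
def curveIntegral (γ : ℝ → ℂ) (k : ℂ → ℂ) : ℂ :=
  ∫ t in (0 : ℝ)..1, k (γ t) * deriv γ t

/-- `γ` is a simple closed rectifiable curve contained in `Ω \ K` and winding once, in the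
positive sense, around every point of `K`.  Rectifiable curves are parametrised by Lipschitz
maps. -/
structure IsEnclosingCurve (Ω K : Set ℂ) (γ : ℝ → ℂ) : Prop where
  rectifiable : ∃ L : NNReal, LipschitzOnWith L γ (Icc 0 1)
  closed : γ 0 = γ 1
  simple : InjOn γ (Ico 0 1)
  subset : ∀ t ∈ Icc (0 : ℝ) 1, γ t ∈ Ω \ K
  winding : ∀ w ∈ K, curveIntegral γ (fun s => (s - w)⁻¹) = 2 * Real.pi * Complex.I

/-- `f(∂ₜ) φ = u` in `Exp(Ω)`: the function `φ` belongs to `Exp(Ω)` and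
`u(z) = (2πi)⁻¹ ∫_γ e^{sz} f(s) B(φ)(s) ds`, where `γ` is a curve in `Ω` that encloses the
singularities of the Borel transform `B(φ)`.  (When `Ω` is simply connected and `f` is holomorphic
on `Ω`, the integral does not depend on the choices, by Cauchy's theorem.) -/
def SymbolEq (Ω : Set ℂ) (f φ u : ℂ → ℂ) : Prop :=
  MemExp Ω φ ∧ ∃ (K : Set ℂ) (B : ℂ → ℂ) (γ : ℝ → ℂ),
    K ⊆ Ω ∧ IsBorelContinuation φ K B ∧ IsEnclosingCurve Ω K γ ∧
    ∀ z : ℂ, u z = (2 * Real.pi * Complex.I)⁻¹ *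
      curveIntegral γ (fun s => Complex.exp (s * z) * f s * B s)

/-- The symbol `ζ(s² + h)`. -/
def zetaSymbol (h : ℝ) (s : ℂ) : ℂ := riemannZeta (s ^ 2 + h)

/-- The plane without the half-lines `Re s ≥ 0`, `|Im s| = √(h - 1)` issuing from the two poles
of `ζ(s² + h)`, for `h > 1`. -/
def slitDomain (h : ℝ) : Set ℂ :=
  {s : ℂ | 0 ≤ s.re ∧ |s.im| = Real.sqrt (h - 1)}ᶜ

/-- The left angular region `|arg s| > 3π/4`, completed around its vertex `0` by the disc
`|s| < √(h - 1)`. -/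
def leftAngularDomain (h : ℝ) : Set ℂ :=
  {s : ℂ | s ≠ 0 ∧ 3 * Real.pi / 4 < |s.arg|} ∪ Metric.ball 0 (Real.sqrt (h - 1))

/-! ### Angular contours

The angular contour `κ^ψ` with radius `δ` and half-opening `ψ ≤ π` consists of the arc
`|s| = δ`, `|arg s| ≤ ψ`, and the two rays `arg s = ± ψ`, `|s| ≥ δ`.  When `ψ = π` the two rays
are the two sides of a cut along the negative half-axis, on which a function may have different
boundary values.  Functions on the closed region `|s| ≥ δ`, `|arg s| ≤ ψ` are therefore written in
the variable `w = log s`, which runs over a closed half-strip. -/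

/-- The value `log t + i θ` of `log s` at `s = t e^{iθ}`. -/
def polarLog (t θ : ℝ) : ℂ := (Real.log t : ℂ) + θ * Complex.I

/-- The closed region `|s| ≥ δ`, `|arg s| ≤ ψ` in the variable `w = log s`. -/
def closedHalfStrip (δ ψ : ℝ) : Set ℂ := {w : ℂ | Real.log δ ≤ w.re ∧ |w.im| ≤ ψ}

/-- The open region `|s| > δ`, `|arg s| < ψ` in the variable `w = log s`. -/
def openHalfStrip (δ ψ : ℝ) : Set ℂ := {w : ℂ | Real.log δ < w.re ∧ |w.im| < ψ}

/-- `∫ H ds / 2πi` over the arc of the contour, counterclockwise. -/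
def arcIntegral (δ ψ : ℝ) (H : ℂ → ℂ) : ℂ :=
  (2 * Real.pi * Complex.I)⁻¹ *
    ∫ θ in (-ψ)..ψ, H (polarLog δ θ) * (Complex.I * δ * Complex.exp (θ * Complex.I))

/-- `∫ H ds / 2πi` over the part `|s| ≤ r` of the contour, from `r e^{-iψ}` to `r e^{iψ}`. -/
def truncatedIntegral (δ ψ r : ℝ) (H : ℂ → ℂ) : ℂ :=
  arcIntegral δ ψ H + (2 * Real.pi * Complex.I)⁻¹ *
    ((∫ t in δ..r, H (polarLog t ψ) * Complex.exp (ψ * Complex.I)) -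
      ∫ t in δ..r, H (polarLog t (-ψ)) * Complex.exp (-ψ * Complex.I))

/-- `∫ H ds / 2πi` over the whole contour, from `∞ e^{-iψ}` to `∞ e^{iψ}`. -/
def angularIntegral (δ ψ : ℝ) (H : ℂ → ℂ) : ℂ :=
  arcIntegral δ ψ H + (2 * Real.pi * Complex.I)⁻¹ *
    ((∫ t in Ioi δ, H (polarLog t ψ) * Complex.exp (ψ * Complex.I)) -
      ∫ t in Ioi δ, H (polarLog t (-ψ)) * Complex.exp (-ψ * Complex.I))

/-- Absolute convergence of the integral of `H` over the whole contour. -/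
def AngularIntegrable (δ ψ : ℝ) (H : ℂ → ℂ) : Prop :=
  IntervalIntegrable (fun θ : ℝ => H (polarLog δ θ)) volume (-ψ) ψ ∧
  IntegrableOn (fun t : ℝ => H (polarLog t ψ)) (Ioi δ) ∧
  IntegrableOn (fun t : ℝ => H (polarLog t (-ψ))) (Ioi δ)

/-! ### The source functions and their truncations -/

/-- The Laplace transform. -/
def laplace (g : ℝ → ℂ) (s : ℂ) : ℂ := ∫ t in Ioi (0 : ℝ), Complex.exp (-(t * s)) * g t

/-- `g` belongs to `L_>(ℝ₊)`, with the region `|s| > δ`, `|arg s| < ψ` as domain of the analytic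
continuation of its Laplace transform: `g` is analytic on `(0, ∞)`, its Laplace integral converges
absolutely on some half-plane `Re s > a`, and there its Laplace transform is `F (log s)`, with `F`
analytic in the region, and continuous and bounded up to the boundary. -/
structure IsSource (g : ℝ → ℂ) (δ ψ : ℝ) (F : ℂ → ℂ) : Prop where
  analytic : AnalyticOnNhd ℝ g (Ioi 0)
  laplace_eq : ∃ a : ℝ,
    (∀ s : ℂ, a < s.re →
      IntegrableOn (fun t : ℝ => Complex.exp (-(t * s)) * g t) (Ioi 0)) ∧
    ∀ w ∈ closedHalfStrip δ ψ, a < (Complex.exp w).re → F w = laplace g (Complex.exp w)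
  differentiableOn : DifferentiableOn ℂ F (openHalfStrip δ ψ)
  continuousOn : ContinuousOn F (closedHalfStrip δ ψ)
  bounded : ∃ M : ℝ, ∀ w ∈ closedHalfStrip δ ψ, ‖F w‖ ≤ M

/-- The integrand `e^{sz} L(g)(s)`, at `s = e^w`. -/
def dataKernel (F : ℂ → ℂ) (z w : ℂ) : ℂ := Complex.exp (Complex.exp w * z) * F w

/-- The integrand `e^{sz} L(g)(s) / ζ(s² + h)`, at `s = e^w`. -/
def solKernel (h : ℝ) (F : ℂ → ℂ) (z w : ℂ) : ℂ :=
  Complex.exp (Complex.exp w * z) * F w / zetaSymbol h (Complex.exp w)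

/-- The truncated source `g_r^ψ`. -/
def gTrunc (δ ψ : ℝ) (F : ℂ → ℂ) (r : ℝ) (z : ℂ) : ℂ :=
  truncatedIntegral δ ψ r (dataKernel F z)

/-- The function `g_∞^ψ`. -/
def gInfty (δ ψ : ℝ) (F : ℂ → ℂ) (z : ℂ) : ℂ := angularIntegral δ ψ (dataKernel F z)

/-- The truncated solution `f_r^ψ`. -/
def fTrunc (h δ ψ : ℝ) (F : ℂ → ℂ) (r : ℝ) (z : ℂ) : ℂ :=
  truncatedIntegral δ ψ r (solKernel h F z)

/-- The function `f_∞^ψ`. -/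
def fInfty (h δ ψ : ℝ) (F : ℂ → ℂ) (z : ℂ) : ℂ := angularIntegral δ ψ (solKernel h F z)

/-- The angular region `D_ψ` with horizontal bisector and half-opening `ψ - π/2`. -/
def angularRegion (ψ : ℝ) : Set ℂ := {z : ℂ | z ≠ 0 ∧ |z.arg| < ψ - Real.pi / 2}

/-- The set `W(g)` of the functions `f_∞^{ψ'}` with `3π/4 < ψ' ≤ ψ`. -/
def solutionSet (h δ ψ : ℝ) (F : ℂ → ℂ) : Set (ℂ → ℂ) :=
  {f | ∃ ψ' ∈ Ioc (3 * Real.pi / 4) ψ, f = fInfty h δ ψ' F}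

/-- Uniform convergence on the compact subsets of `D`, as `r → ∞`. -/
def CompactConv (u : ℝ → ℂ → ℂ) (v : ℂ → ℂ) (D : Set ℂ) : Prop :=
  ∀ K ⊆ D, IsCompact K → TendstoUniformlyOn u v atTop K

/-- `G` is the value of the operator `ζ̃(∂ₜ² + h)` at `f` on `D_ψ`: there is a family of solutions
`φ r` of the truncated equations `ζ(∂ₜ² + h) (φ r) = g_r^ψ` that converges to `f` uniformly on
compact sets of `D_ψ`, and `G` is the limit of `ζ(∂ₜ² + h) (φ r)` in the same sense. -/
def IsZetaTilde (h δ ψ : ℝ) (F f G : ℂ → ℂ) : Prop :=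
  ∃ φ u : ℝ → ℂ → ℂ,
    (∀ r > δ, SymbolEq (leftAngularDomain h) (zetaSymbol h) (φ r) (u r) ∧
      u r = gTrunc δ ψ F r) ∧
    CompactConv φ f (angularRegion ψ) ∧ CompactConv u G (angularRegion ψ)

end ZetaNonlocal

end

/-! A truncated contour integral is a superposition of exponentials `e^{sz}` against integrable
coefficients, with frequencies `s` on a compact set `K`. Such a function is entire of exponential
type. Its Taylor coefficients are moments of the coefficients, so its Borel transform is a Cauchy
transform, holomorphic off `K`. By Fubini and Cauchy's formula, the operator with symbol `k`
multiplies the coefficient at frequency `s` by `k s` (`IsExpData.actsAs`). For `k = ζ(s² + h)` this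
undoes the division by the symbol, which gives the truncated equation. The remaining geometric point
is a closed curve around the contour inside the left angular domain for which Cauchy's formula holds
(`exists_enclosingCurve`): it is written in polar coordinates and contracted radially.

The division is harmless because `Re (s² + h) ≥ h - δ² > 1` on all the contours involved: `s²` has
nonnegative real part when `3π/4 ≤ |arg s| ≤ π`, and has modulus `δ² < h - 1` on the arc
(`re_symbol_ge`). There `1/ζ` is given by the Möbius series and is bounded. Thus `L(g)/ζ` and `L(g)`
are both bounded continuous coefficients (`IsCoeff`). On the rays `e^{sz}` decays exponentially,
uniformly for `z` in compact subsets of the angular region, so the truncations converge locally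
uniformly to analytic limits (`IsCoeff.compactConv`). Cauchy's theorem between two contours gives
independence of the opening (`IsCoeff.angularIntegral_eq_of_le`).

Recovering `g` needs a detour, since `L(g)` is only bounded and Fubini is not directly available for
the Laplace transform of the contour integral. With `L(g)(s)/s` in place of `L(g)(s)` the integrals
converge. By `laplace_angularIntegral` and `angularIntegral_cauchy` the resulting function has the
Laplace transform `L(g)(S)/S`, which is also that of the primitive of `g`. Fourier inversion
identifies the two functions on `(0, ∞)`, and differentiation gives `g` (`IsSource.gInfty_eq`).

The variable `w = log s` is used throughout because at `ψ = π` the two rays have the same trace but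
may carry different boundary values. It also turns annular sectors into rectangles. -/

noncomputable section

namespace ZetaNonlocal

/-! ### Superpositions of exponentials -/

/-- The superposition `∫ e^{s(x) z} c(x) dμ(x)` of exponentials with frequencies `s`. -/
def expIntegral (μ : Measure ℝ) (s c : ℝ → ℂ) (z : ℂ) : ℂ :=
  ∫ x, Complex.exp (s x * z) * c x ∂μ

/-- The Cauchy transform `∫ c(x) / (z - s(x)) dμ(x)`. -/
def cauchyTransform (μ : Measure ℝ) (s c : ℝ → ℂ) (z : ℂ) : ℂ :=
  ∫ x, c x / (z - s x) ∂μ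

/-- Frequencies lying in the compact set `K`, with integrable coefficients. -/
structure IsExpData (K : Set ℂ) (μ : Measure ℝ) (s c : ℝ → ℂ) : Prop where
  isCompact : IsCompact K
  aesm : AEStronglyMeasurable s μ
  mem : ∀ᵐ x ∂μ, s x ∈ K
  integrable : Integrable c μ

namespace IsExpData

variable {K : Set ℂ} {μ : Measure ℝ} {s c : ℝ → ℂ}

lemma integrable_mul (H : IsExpData K μ s c) {k : ℂ → ℂ} (hk : Measurable k) {M : ℝ}
    (hM : ∀ w ∈ K, ‖k w‖ ≤ M) : Integrable (fun x => k (s x) * c x) μ :=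
  H.integrable.bdd_mul (hk.comp_aemeasurable H.aesm.aemeasurable).aestronglyMeasurable
    (H.mem.mono fun _ hx => hM _ hx)

lemma exists_bound (H : IsExpData K μ s c) : ∃ R : ℝ, 0 ≤ R ∧ ∀ w ∈ K, ‖w‖ ≤ R := by
  obtain ⟨R, hR⟩ := H.isCompact.isBounded.exists_norm_le
  exact ⟨max R 0, le_max_right _ _, fun w hw => (hR w hw).trans (le_max_left _ _)⟩

lemma norm_exp_mul_le {w z : ℂ} {R T : ℝ} (hw : ‖w‖ ≤ R) (hz : ‖z‖ ≤ T) :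
    ‖Complex.exp (w * z)‖ ≤ Real.exp (R * T) := by
  rw [Complex.norm_exp]
  refine Real.exp_le_exp.2 ((Complex.re_le_norm _).trans ?_)
  rw [norm_mul]
  exact mul_le_mul hw hz (norm_nonneg _) ((norm_nonneg _).trans hw)

lemma integrable_exp (H : IsExpData K μ s c) (z : ℂ) :
    Integrable (fun x => Complex.exp (s x * z) * c x) μ := by
  obtain ⟨R, -, hR⟩ := H.exists_bound
  exact H.integrable_mul (k := fun w => Complex.exp (w * z)) (by fun_prop)
    (fun w hw => norm_exp_mul_le (hR w hw) le_rfl)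

/-- Keeps the class stable under differentiation in `z`, so that the Taylor coefficients at `0`
become the moments `∫ s^n c`. -/
lemma pow_mul (H : IsExpData K μ s c) (n : ℕ) : IsExpData K μ s (fun x => s x ^ n * c x) := by
  obtain ⟨R, hR0, hR⟩ := H.exists_bound
  refine ⟨H.isCompact, H.aesm, H.mem, H.integrable_mul (k := fun w => w ^ n) (by fun_prop)
    (M := R ^ n) fun w hw => ?_⟩
  rw [norm_pow]
  exact pow_le_pow_left₀ (norm_nonneg _) (hR w hw) n

lemma hasDerivAt (H : IsExpData K μ s c) (z : ℂ) :
    HasDerivAt (expIntegral μ s c) (expIntegral μ s (fun x => s x * c x) z) z := by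
  obtain ⟨R, hR0, hR⟩ := H.exists_bound
  have H1 : IsExpData K μ s (fun x => s x * c x) := by simpa using H.pow_mul 1
  refine (hasDerivAt_integral_of_dominated_loc_of_deriv_le (𝕜 := ℂ)
    (F := fun z x => Complex.exp (s x * z) * c x)
    (F' := fun z x => Complex.exp (s x * z) * (s x * c x))
    (bound := fun x => Real.exp (R * (‖z‖ + 1)) * ‖s x * c x‖) (Metric.ball_mem_nhds z one_pos)
    (Eventually.of_forall fun y => (H.integrable_exp y).aestronglyMeasurable)
    (H.integrable_exp z) (H1.integrable_exp z).aestronglyMeasurable ?_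
    (H1.integrable.norm.const_mul _) ?_).2
  · filter_upwards [H.mem] with x hx y hy
    rw [norm_mul]
    refine mul_le_mul_of_nonneg_right (norm_exp_mul_le (hR _ hx) ?_) (norm_nonneg _)
    have : ‖y - z‖ < 1 := by simpa [dist_eq_norm] using hy
    linarith [norm_sub_norm_le y z]
  · refine Eventually.of_forall fun x y _ => ?_
    have h1 : HasDerivAt (fun y : ℂ => s x * y) (s x) y := by
      simpa using (hasDerivAt_id y).const_mul (s x)
    refine (h1.cexp.mul_const (c x)).congr_deriv ?_
    ring

lemma differentiable (H : IsExpData K μ s c) : Differentiable ℂ (expIntegral μ s c) :=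
  fun z => (H.hasDerivAt z).differentiableAt

lemma iteratedDeriv_eq (H : IsExpData K μ s c) (n : ℕ) :
    iteratedDeriv n (expIntegral μ s c) = expIntegral μ s (fun x => s x ^ n * c x) := by
  induction n with
  | zero => simp
  | succ n ih =>
    rw [iteratedDeriv_succ, ih]
    ext z
    rw [((H.pow_mul n).hasDerivAt z).deriv]
    simp only [expIntegral, pow_succ']
    simp only [mul_assoc]

lemma exists_norm_le (H : IsExpData K μ s c) :
    ∃ C τ : ℝ, 0 ≤ C ∧ 0 ≤ τ ∧ ∀ z : ℂ, ‖expIntegral μ s c z‖ ≤ C * Real.exp (τ * ‖z‖) := by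
  obtain ⟨R, hR0, hR⟩ := H.exists_bound
  refine ⟨∫ x, ‖c x‖ ∂μ, R, integral_nonneg fun _ => norm_nonneg _, hR0, fun z => ?_⟩
  rw [← integral_mul_const]
  refine norm_integral_le_of_norm_le (H.integrable.norm.mul_const _) ?_
  filter_upwards [H.mem] with x hx
  rw [norm_mul, mul_comm]
  exact mul_le_mul_of_nonneg_left (norm_exp_mul_le (hR _ hx) le_rfl) (norm_nonneg _)

/-- Beyond the radius of `K`, expand `1/(z - s)` in a geometric series. Sum and integral are
exchanged because the `L¹` norms are dominated by a geometric sequence of ratio `R / ‖z‖`. -/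
lemma hasSum (H : IsExpData K μ s c) : ∃ R : ℝ, ∀ z : ℂ, R < ‖z‖ →
    HasSum (fun n : ℕ => iteratedDeriv n (expIntegral μ s c) 0 / z ^ (n + 1))
      (cauchyTransform μ s c z) := by
  obtain ⟨R, hR0, hR⟩ := H.exists_bound
  refine ⟨R, fun z hz => ?_⟩
  have hz0 : 0 < ‖z‖ := hR0.trans_lt hz
  have hz0' : z ≠ 0 := norm_pos_iff.1 hz0
  have key := hasSum_integral_of_summable_integral_norm (μ := μ)
    (F := fun (n : ℕ) x => s x ^ n * c x / z ^ (n + 1))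
    (fun n => (H.pow_mul n).integrable.div_const _) ?_
  · convert key using 1
    · rfl
    · ext n
      rw [H.iteratedDeriv_eq, integral_div]
      simp [expIntegral]
    · refine integral_congr_ae ?_
      filter_upwards [H.mem] with x hx
      have hlt : ‖s x / z‖ < 1 := by
        rw [norm_div, div_lt_one hz0]
        exact (hR _ hx).trans_lt hz
      have hne : z - s x ≠ 0 := fun h0 => by
        rw [← sub_eq_zero.1 h0] at hx
        exact absurd (hR _ hx) (not_le.2 hz)
      have h1 := (hasSum_geometric_of_norm_lt_one hlt).mul_left (c x / z)
      have h2 : c x / z * (1 - s x / z)⁻¹ = c x / (z - s x) := by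
        rw [one_sub_div hz0', inv_div]
        field_simp
      rw [h2] at h1
      rw [← h1.tsum_eq]
      congr 1; ext n
      rw [div_pow, pow_succ]
      field_simp
  · refine Summable.of_nonneg_of_le (fun n => integral_nonneg fun _ => norm_nonneg _)
      (f := fun n => (R / ‖z‖) ^ n * ((∫ x, ‖c x‖ ∂μ) / ‖z‖)) (fun n => ?_)
      ((summable_geometric_of_lt_one (by positivity) ((div_lt_one hz0).2 hz)).mul_right _)
    have h3 : (R / ‖z‖) ^ n * ((∫ x, ‖c x‖ ∂μ) / ‖z‖) =
        ∫ x, R ^ n / ‖z‖ ^ (n + 1) * ‖c x‖ ∂μ := by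
      rw [integral_const_mul, div_pow, pow_succ]
      field_simp
    rw [h3]
    refine integral_mono_ae ((H.pow_mul n).integrable.div_const _).norm
      (H.integrable.norm.const_mul _) ?_
    filter_upwards [H.mem] with x hx
    simp only [norm_div, norm_mul, norm_pow]
    rw [div_mul_eq_mul_div]
    have := hR _ hx
    gcongr

lemma differentiableOn_cauchyTransform (H : IsExpData K μ s c) :
    DifferentiableOn ℂ (cauchyTransform μ s c) Kᶜ := by
  intro z hz
  obtain ⟨ε, hε, hball⟩ := Metric.isOpen_iff.1 H.isCompact.isClosed.isOpen_compl z hz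
  -- The ball of radius `ε` misses `K`, so on the ball of half the radius the denominators are at
  -- least `ε / 2`; this dominates the integrand and its derivative.
  have hdist : ∀ w ∈ K, ∀ y ∈ Metric.ball z (ε / 2), ε / 2 ≤ ‖y - w‖ := by
    intro w hw y hy
    by_contra! hlt
    refine hball (?_ : w ∈ Metric.ball z ε) hw
    rw [Metric.mem_ball, dist_comm] at *
    rw [← dist_eq_norm] at hlt
    linarith [dist_triangle z y w]
  have hint : ∀ y ∈ Metric.ball z (ε / 2), Integrable (fun x => c x / (y - s x)) μ := by
    intro y hy
    refine (H.integrable_mul (k := fun w => (y - w)⁻¹) (by fun_prop) (M := (ε / 2)⁻¹)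
      fun w hw => ?_).congr (Eventually.of_forall fun x => ?_)
    · rw [norm_inv]
      exact inv_anti₀ (by positivity) (hdist w hw y hy)
    · simp only []; ring
  have hmem : Metric.ball z (ε / 2) ∈ 𝓝 z := Metric.ball_mem_nhds _ (by positivity)
  refine (hasDerivAt_integral_of_dominated_loc_of_deriv_le (𝕜 := ℂ)
    (F := fun z x => c x / (z - s x)) (F' := fun z x => -(c x / (z - s x) ^ 2))
    (bound := fun x => ‖c x‖ / (ε / 2) ^ 2) hmem
    (eventually_of_mem hmem fun y hy => (hint y hy).aestronglyMeasurable)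
    (hint z (mem_of_mem_nhds hmem)) ?_ ?_ (H.integrable.norm.div_const _)
    ?_).2.differentiableAt.differentiableWithinAt
  · refine (AEMeasurable.neg (H.integrable.aemeasurable.div ?_)).aestronglyMeasurable
    exact (aemeasurable_const.sub H.aesm.aemeasurable).pow_const 2
  · filter_upwards [H.mem] with x hx y hy
    rw [norm_neg, norm_div, norm_pow]
    have := hdist _ hx y hy
    gcongr
  · filter_upwards [H.mem] with x hx y hy
    have hne : y - s x ≠ 0 := norm_pos_iff.1 ((half_pos hε).trans_le (hdist _ hx y hy))
    have h1 := (((hasDerivAt_id y).sub_const (s x)).inv hne).const_mul (c x)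
    simp only [div_eq_mul_inv]
    refine h1.congr_deriv ?_
    simp [div_eq_mul_inv]

lemma isBorelContinuation (H : IsExpData K μ s c) :
    IsBorelContinuation (expIntegral μ s c) K (cauchyTransform μ s c) :=
  ⟨H.isCompact, H.differentiableOn_cauchyTransform, H.hasSum⟩

end IsExpData

/-- Used to assemble the arc and the two rays, whose frequencies lie in one common compact set. -/
lemma IsBorelContinuation.add {φ₁ φ₂ B₁ B₂ : ℂ → ℂ} {K : Set ℂ}
    (h₁ : IsBorelContinuation φ₁ K B₁) (h₂ : IsBorelContinuation φ₂ K B₂)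
    (d₁ : Differentiable ℂ φ₁) (d₂ : Differentiable ℂ φ₂) :
    IsBorelContinuation (φ₁ + φ₂) K (B₁ + B₂) := by
  refine ⟨h₁.isCompact, h₁.differentiableOn.add h₂.differentiableOn, ?_⟩
  obtain ⟨R₁, hR₁⟩ := h₁.hasSum
  obtain ⟨R₂, hR₂⟩ := h₂.hasSum
  refine ⟨max R₁ R₂, fun z hz => ?_⟩
  have := (hR₁ z ((le_max_left _ _).trans_lt hz)).add (hR₂ z ((le_max_right _ _).trans_lt hz))
  have he : (fun n : ℕ => iteratedDeriv n (φ₁ + φ₂) 0 / z ^ (n + 1)) =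
      fun n => iteratedDeriv n φ₁ 0 / z ^ (n + 1) + iteratedDeriv n φ₂ 0 / z ^ (n + 1) := by
    ext n
    rw [iteratedDeriv_add d₁.contDiff.contDiffAt d₂.contDiff.contDiffAt, add_div]
  rw [he]
  exact this

/-- Interchange of a curve integral with a Cauchy transform. -/
lemma IsExpData.curveIntegral_mul_cauchyTransform {K : Set ℂ} {μ : Measure ℝ} [SFinite μ]
    {s c : ℝ → ℂ} (H : IsExpData K μ s c) {γ : ℝ → ℂ} (hγ : ContDiff ℝ 1 γ)
    (hγK : ∀ t ∈ Icc (0 : ℝ) 1, γ t ∉ K) {k : ℂ → ℂ}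
    (hk : ContinuousOn (fun t => k (γ t)) (Icc 0 1))
    (hC : ∀ w ∈ K, curveIntegral γ (fun ζ => k ζ / (ζ - w)) = 2 * Real.pi * Complex.I * k w) :
    IntervalIntegrable (fun t => k (γ t) * cauchyTransform μ s c (γ t) * deriv γ t) volume 0 1 ∧
    curveIntegral γ (fun ζ => k ζ * cauchyTransform μ s c ζ) =
      2 * Real.pi * Complex.I * ∫ x, k (s x) * c x ∂μ := by
  have hd : Continuous (deriv γ) := hγ.continuous_deriv le_rfl
  have hI : IsCompact (γ '' Icc 0 1) := isCompact_Icc.image hγ.continuous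
  -- The curve and `K` are disjoint compact sets, so the Cauchy kernel is bounded on their product.
  -- This is the domination needed for Fubini.
  obtain ⟨M, hM⟩ := (hI.prod H.isCompact).exists_bound_of_continuousOn
    (f := fun p : ℂ × ℂ => (p.1 - p.2)⁻¹) (by
      refine ContinuousOn.inv₀ (by fun_prop) ?_
      rintro ⟨a, b⟩ ⟨⟨t, ht, rfl⟩, hb⟩ h0
      have h1 : γ t = b := sub_eq_zero.1 h0
      exact hγK t ht (h1 ▸ hb))
  set ν : Measure ℝ := volume.restrict (Ioc 0 1) with hν
  have hsub : Ioc (0 : ℝ) 1 ⊆ Icc 0 1 := Ioc_subset_Icc_self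
  have hA : Integrable (fun t => k (γ t) * deriv γ t) ν :=
    ((hk.mul hd.continuousOn).integrableOn_Icc).mono_set hsub
  have hprod : Integrable (fun p : ℝ × ℝ => (γ p.1 - s p.2)⁻¹ * (k (γ p.1) * deriv γ p.1 * c p.2))
      (ν.prod μ) := by
    refine (hA.mul_prod H.integrable).bdd_mul (c := M) ?_ ?_
    · refine AEMeasurable.aestronglyMeasurable (AEMeasurable.inv ?_)
      exact (hγ.continuous.measurable.comp measurable_fst).aemeasurable.sub
        H.aesm.aemeasurable.comp_snd
    · have h1 : ∀ᵐ p ∂(ν.prod μ), p.1 ∈ Ioc (0 : ℝ) 1 :=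
        Measure.quasiMeasurePreserving_fst.ae (ae_restrict_mem measurableSet_Ioc)
      have h2 : ∀ᵐ p ∂(ν.prod μ), s p.2 ∈ K := Measure.quasiMeasurePreserving_snd.ae H.mem
      filter_upwards [h1, h2] with p hp1 hp2
      exact hM (γ p.1, s p.2) ⟨⟨_, hsub hp1, rfl⟩, hp2⟩
  have hinner : ∀ t, ∫ x, (γ t - s x)⁻¹ * (k (γ t) * deriv γ t * c x) ∂μ =
      k (γ t) * cauchyTransform μ s c (γ t) * deriv γ t := by
    intro t
    simp only [cauchyTransform]
    rw [mul_right_comm, ← integral_const_mul]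
    congr 1; ext x; ring
  constructor
  · rw [intervalIntegrable_iff_integrableOn_Ioc_of_le zero_le_one]
    exact hprod.integral_prod_left.congr (Eventually.of_forall hinner)
  · rw [curveIntegral, intervalIntegral.integral_of_le zero_le_one]
    simp only [← hinner]
    rw [integral_integral_swap hprod, ← integral_const_mul]
    refine integral_congr_ae ?_
    filter_upwards [H.mem] with x hx
    rw [← mul_assoc, ← hC _ hx, curveIntegral, intervalIntegral.integral_of_le zero_le_one,
      ← integral_mul_const]
    congr 1; ext t; ring

/-! ### Cauchy's formula for closed curves in a star-shaped domain -/

/-- If `∂Φ/∂l = ∂Ψ/∂t` and `Ψ` takes the same values at both ends, then the integral of `Φ`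
over `t` does not depend on `l`. -/
lemma integral_eq_of_deformation {Φ Ψ G : ℝ → ℝ → ℂ}
    (hΦ : ∀ l ∈ Icc (0 : ℝ) 1, ∀ t ∈ Icc (0 : ℝ) 1, HasDerivAt (fun l => Φ l t) (G l t) l)
    (hΨ : ∀ l ∈ Icc (0 : ℝ) 1, ∀ t ∈ Icc (0 : ℝ) 1, HasDerivAt (Ψ l) (G l t) t)
    (hG : ContinuousOn (fun p : ℝ × ℝ => G p.1 p.2) (Icc 0 1 ×ˢ Icc 0 1))
    (hΦc : ∀ l ∈ Icc (0 : ℝ) 1, ContinuousOn (Φ l) (Icc 0 1))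
    (hend : ∀ l ∈ Icc (0 : ℝ) 1, Ψ l 0 = Ψ l 1) :
    ∫ t in (0 : ℝ)..1, Φ 1 t = ∫ t in (0 : ℝ)..1, Φ 0 t := by
  have hu : uIcc (0 : ℝ) 1 = Icc 0 1 := uIcc_of_le zero_le_one
  have hi : ∀ l ∈ Icc (0 : ℝ) 1, IntervalIntegrable (Φ l) volume 0 1 := fun l hl =>
    ContinuousOn.intervalIntegrable (by rw [hu]; exact hΦc l hl)
  have hG1 : ∀ t ∈ Icc (0 : ℝ) 1, IntervalIntegrable (fun l => G l t) volume 0 1 := fun t ht =>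
    ContinuousOn.intervalIntegrable (by
      rw [hu]
      exact hG.comp (f := fun l : ℝ => (l, t)) (by fun_prop) fun l hl => ⟨hl, ht⟩)
  have hG2 : ∀ l ∈ Icc (0 : ℝ) 1, IntervalIntegrable (fun t => G l t) volume 0 1 := fun l hl =>
    ContinuousOn.intervalIntegrable (by
      rw [hu]
      exact hG.comp (f := fun t : ℝ => (l, t)) (by fun_prop) fun t ht => ⟨hl, ht⟩)
  rw [← sub_eq_zero, ← intervalIntegral.integral_sub (hi 1 (by simp)) (hi 0 (by simp))]
  -- The difference is the double integral of `G`. Integrated over `t` first, it vanishes for each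
  -- `l`, because `Ψ l` has equal end values.
  have h1 : ∫ t in (0 : ℝ)..1, (Φ 1 t - Φ 0 t) =
      ∫ t in (0 : ℝ)..1, ∫ l in (0 : ℝ)..1, G l t := by
    refine intervalIntegral.integral_congr fun t ht => ?_
    rw [hu] at ht
    exact (intervalIntegral.integral_eq_sub_of_hasDerivAt (f := fun l => Φ l t)
      (f' := fun l => G l t) (fun l hl => hΦ l (hu ▸ hl) t ht) (hG1 t ht)).symm
  have h2 : ∫ l in (0 : ℝ)..1, ∫ t in (0 : ℝ)..1, G l t = 0 := by
    refine (intervalIntegral.integral_congr (g := fun _ => (0 : ℂ)) fun l hl => ?_).trans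
      intervalIntegral.integral_zero
    rw [hu] at hl
    rw [intervalIntegral.integral_eq_sub_of_hasDerivAt
      (fun t ht => hΨ l hl t (hu ▸ ht)) (hG2 l hl), hend l hl, sub_self]
  rw [h1, ← h2]
  simp only [intervalIntegral.integral_of_le zero_le_one]
  refine integral_integral_swap (f := fun t l => G l t) ?_
  rw [Measure.prod_restrict]
  have h3 : IntegrableOn (fun p : ℝ × ℝ => G p.1 p.2) (Icc 0 1 ×ˢ Icc 0 1)
      ((volume : Measure ℝ).prod volume) :=
    hG.integrableOn_compact (isCompact_Icc.prod isCompact_Icc)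
  have h4 := h3.mono_set (t := Icc 0 1 ×ˢ Icc 0 1) (prod_mono Ioc_subset_Icc_self Ioc_subset_Icc_self)
  rw [IntegrableOn, ← Measure.prod_restrict] at h4
  have := h4.swap
  rwa [Measure.prod_restrict] at this

/-- Cauchy's theorem for a closed curve that can be contracted radially. -/
lemma curveIntegral_eq_zero_of_starShaped {Ω : Set ℂ} (hΩ : IsOpen Ω) {f : ℂ → ℂ}
    (hf : DifferentiableOn ℂ f Ω) {γ : ℝ → ℂ} (hγ : ContDiff ℝ 1 γ) (hclosed : γ 0 = γ 1)
    (hstar : ∀ l ∈ Icc (0 : ℝ) 1, ∀ t ∈ Icc (0 : ℝ) 1, (l : ℂ) * γ t ∈ Ω) :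
    curveIntegral γ f = 0 := by
  have hd : Continuous (deriv γ) := hγ.continuous_deriv le_rfl
  have hγc := hγ.continuous
  have hγd : ∀ t, HasDerivAt γ (deriv γ t) t := fun t =>
    (hγ.differentiable one_ne_zero t).hasDerivAt
  have hfd : ∀ z ∈ Ω, HasDerivAt f (deriv f z) z := fun z hz =>
    (hf.differentiableAt (hΩ.mem_nhds hz)).hasDerivAt
  have hf' : ContinuousOn (deriv f) Ω := (hf.deriv hΩ).continuousOn
  have hcomp : ∀ {k : ℂ → ℂ}, ContinuousOn k Ω →
      ContinuousOn (fun p : ℝ × ℝ => k ((p.1 : ℂ) * γ p.2)) (Icc 0 1 ×ˢ Icc 0 1) := fun hk =>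
    hk.comp (f := fun p : ℝ × ℝ => (p.1 : ℂ) * γ p.2) (by fun_prop) fun p hp =>
      hstar _ hp.1 _ hp.2
  -- `Φ` and `Ψ` are the `dt` and `dl` components of the pullback of `f(ζ) dζ` under `(l, t) ↦ l
  -- γ(t)`, a closed form. At `l = 0` the curve is constant and its integral is zero.
  have key := integral_eq_of_deformation
    (Φ := fun l t => f (l * γ t) * (l * deriv γ t))
    (Ψ := fun l t => f (l * γ t) * γ t)
    (G := fun l t => deriv f (l * γ t) * γ t * (l * deriv γ t) + f (l * γ t) * deriv γ t)
    ?_ ?_ ?_ ?_ ?_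
  · simpa [curveIntegral] using key
  · intro l hl t ht
    have h1 : HasDerivAt (fun l : ℝ => (l : ℂ) * γ t) (γ t) l := by
      simpa using (Complex.ofRealCLM.hasDerivAt (x := l)).mul_const (γ t)
    have h2 : HasDerivAt (fun l : ℝ => (l : ℂ) * deriv γ t) (deriv γ t) l := by
      simpa using (Complex.ofRealCLM.hasDerivAt (x := l)).mul_const (deriv γ t)
    exact ((hfd _ (hstar l hl t ht)).comp_of_eq l h1 rfl).mul h2
  · intro l hl t ht
    have h1 : HasDerivAt (fun t : ℝ => (l : ℂ) * γ t) (l * deriv γ t) t := (hγd t).const_mul _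
    refine (((hfd _ (hstar l hl t ht)).comp_of_eq t h1 rfl).mul (hγd t)).congr_deriv ?_
    simp only [Function.comp]
    ring
  · have h1 : Continuous fun p : ℝ × ℝ => γ p.2 := by fun_prop
    have h2 : Continuous fun p : ℝ × ℝ => deriv γ p.2 := by fun_prop
    have h3 : Continuous fun p : ℝ × ℝ => (p.1 : ℂ) := by fun_prop
    exact (((hcomp hf').mul h1.continuousOn).mul (h3.mul h2).continuousOn).add
      ((hcomp hf.continuousOn).mul h2.continuousOn)
  · intro l hl
    have h1 : ContinuousOn (fun t : ℝ => f (l * γ t)) (Icc 0 1) :=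
      (hcomp hf.continuousOn).comp (f := fun t : ℝ => (l, t)) (by fun_prop) fun t ht => ⟨hl, ht⟩
    exact h1.mul (continuous_const.mul hd).continuousOn
  · intro l _
    simp only [hclosed]

/-- The winding number does not change when the point moves to `0` along a ray that does not meet
the curve. -/
lemma curveIntegral_sub_inv_eq {γ : ℝ → ℂ} (hγ : ContDiff ℝ 1 γ) (hclosed : γ 0 = γ 1) {w : ℂ}
    (hw : ∀ l ∈ Icc (0 : ℝ) 1, ∀ t ∈ Icc (0 : ℝ) 1, γ t ≠ l * w) :
    curveIntegral γ (fun s => (s - w)⁻¹) = curveIntegral γ (fun s => s⁻¹) := by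
  have hd : Continuous (deriv γ) := hγ.continuous_deriv le_rfl
  have hγc := hγ.continuous
  have hγd : ∀ t, HasDerivAt γ (deriv γ t) t := fun t =>
    (hγ.differentiable one_ne_zero t).hasDerivAt
  -- Same scheme, with the pullback of `dζ/ζ` under `(l, t) ↦ γ(t) - l w`.
  have key := integral_eq_of_deformation
    (Φ := fun l t => (γ t - l * w)⁻¹ * deriv γ t)
    (Ψ := fun l t => -(w * (γ t - l * w)⁻¹))
    (G := fun l t => w / (γ t - l * w) ^ 2 * deriv γ t)
    ?_ ?_ ?_ ?_ ?_
  · simpa [curveIntegral] using key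
  · intro l hl t ht
    have h1 : HasDerivAt (fun l : ℝ => γ t - (l : ℂ) * w) (-w) l := by
      simpa using ((Complex.ofRealCLM.hasDerivAt (x := l)).mul_const w).const_sub (γ t)
    have := (h1.inv (sub_ne_zero.2 (hw l hl t ht))).mul_const (deriv γ t)
    simpa using this
  · intro l hl t ht
    have h1 : HasDerivAt (fun t : ℝ => γ t - (l : ℂ) * w) (deriv γ t) t := (hγd t).sub_const _
    refine ((h1.inv (sub_ne_zero.2 (hw l hl t ht))).const_mul w).neg.congr_deriv ?_
    ring
  · refine ContinuousOn.mul (ContinuousOn.div continuousOn_const (by fun_prop) ?_) (by fun_prop)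
    rintro ⟨l, t⟩ ⟨hl, ht⟩
    exact pow_ne_zero 2 (sub_ne_zero.2 (hw l hl t ht))
  · intro l hl
    refine ContinuousOn.mul (ContinuousOn.inv₀ (by fun_prop) ?_) (by fun_prop)
    exact fun t ht => sub_ne_zero.2 (hw l hl t ht)
  · intro l _
    simp only [hclosed]

/-- Cauchy's integral formula for a closed curve that can be contracted radially. -/
lemma curveIntegral_div_sub {Ω : Set ℂ} (hΩ : IsOpen Ω) {f : ℂ → ℂ}
    (hf : DifferentiableOn ℂ f Ω) {γ : ℝ → ℂ} (hγ : ContDiff ℝ 1 γ) (hclosed : γ 0 = γ 1)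
    (hstar : ∀ l ∈ Icc (0 : ℝ) 1, ∀ t ∈ Icc (0 : ℝ) 1, (l : ℂ) * γ t ∈ Ω) {w : ℂ} (hwΩ : w ∈ Ω)
    (hw : ∀ t ∈ Icc (0 : ℝ) 1, γ t ≠ w)
    (hwind : curveIntegral γ (fun s => (s - w)⁻¹) = 2 * Real.pi * Complex.I) :
    curveIntegral γ (fun s => f s / (s - w)) = 2 * Real.pi * Complex.I * f w := by
  -- On the curve, `f(s)/(s - w) = dslope f w s + f(w)/(s - w)`. The first term is holomorphic on
  -- `Ω` and integrates to zero; the second gives the winding number.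
  have hg : DifferentiableOn ℂ (dslope f w) Ω :=
    (Complex.differentiableOn_dslope (hΩ.mem_nhds hwΩ)).2 hf
  have h0 := curveIntegral_eq_zero_of_starShaped hΩ hg hγ hclosed hstar
  have hd : Continuous (deriv γ) := hγ.continuous_deriv le_rfl
  have hγc := hγ.continuous
  have hu : uIcc (0 : ℝ) 1 = Icc 0 1 := uIcc_of_le zero_le_one
  have hγΩ : ∀ t ∈ Icc (0 : ℝ) 1, γ t ∈ Ω := fun t ht => by simpa using hstar 1 (by simp) t ht
  have i1 : IntervalIntegrable (fun t => dslope f w (γ t) * deriv γ t) volume 0 1 := by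
    refine ContinuousOn.intervalIntegrable ?_
    rw [hu]
    exact (hg.continuousOn.comp hγc.continuousOn hγΩ).mul hd.continuousOn
  have i2 : IntervalIntegrable (fun t => f w * ((γ t - w)⁻¹ * deriv γ t)) volume 0 1 := by
    refine ContinuousOn.intervalIntegrable ?_
    rw [hu]
    refine continuousOn_const.mul (ContinuousOn.mul (ContinuousOn.inv₀ (by fun_prop) ?_)
      hd.continuousOn)
    exact fun t ht => sub_ne_zero.2 (hw t ht)
  rw [← hwind, mul_comm _ (f w)]
  simp only [curveIntegral] at h0 ⊢
  rw [← intervalIntegral.integral_const_mul, ← sub_eq_zero, ← h0, sub_eq_iff_eq_add,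
    ← intervalIntegral.integral_add i1 i2]
  refine intervalIntegral.integral_congr fun t ht => ?_
  rw [hu] at ht
  have hne := hw t ht
  have hne' : γ t - w ≠ 0 := sub_ne_zero.2 hne
  rw [dslope_of_ne _ hne, slope_def_field]
  field_simp
  ring

/-! ### Closed curves in polar coordinates -/

/-- The closed curve `e^{u(θ) + iθ}`, `-π ≤ θ ≤ π`. -/
def polarCurve (u : ℝ → ℝ) (t : ℝ) : ℂ :=
  Complex.exp ((u (2 * Real.pi * t - Real.pi) : ℂ) + (2 * Real.pi * t - Real.pi : ℝ) * Complex.I)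

lemma polarCurve_contDiff {u : ℝ → ℝ} (hu : ContDiff ℝ 1 u) : ContDiff ℝ 1 (polarCurve u) := by
  unfold polarCurve
  have h1 : ContDiff ℝ 1 (fun t : ℝ => ((u (2 * Real.pi * t - Real.pi) : ℝ) : ℂ)) :=
    Complex.ofRealCLM.contDiff.comp (hu.comp (by fun_prop))
  have h2 : ContDiff ℝ 1 (fun t : ℝ => ((2 * Real.pi * t - Real.pi : ℝ) : ℂ)) :=
    Complex.ofRealCLM.contDiff.comp ((contDiff_const.mul contDiff_id).sub contDiff_const)
  exact (h1.add (h2.mul contDiff_const)).cexp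

/-- The exponents differ by `2πn i` with `|n| ≤ 1`. The values `n = ±1` are the identification of
the two sides of the cut at angle `±π`, which does occur when `ψ = π`. -/
lemma exp_polar_eq {x y a b : ℝ} (ha : |a| ≤ Real.pi) (hb : |b| ≤ Real.pi)
    (h : Complex.exp ((x : ℂ) + a * Complex.I) = Complex.exp ((y : ℂ) + b * Complex.I)) :
    x = y ∧ (a = b ∨ |a| = Real.pi ∧ b = -a) := by
  obtain ⟨n, hn⟩ := Complex.exp_eq_exp_iff_exists_int.1 h
  have hre := congrArg Complex.re hn
  have him := congrArg Complex.im hn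
  simp at hre him
  refine ⟨hre, ?_⟩
  have hpi := Real.pi_pos
  have hab : |a - b| ≤ 2 * Real.pi := (abs_sub _ _).trans (by linarith)
  have h1 : a - b = n * (2 * Real.pi) := by linarith
  have hn1 : |n| ≤ 1 := by
    rw [h1, abs_mul, abs_of_pos (by positivity : (0 : ℝ) < 2 * Real.pi)] at hab
    have : |(n : ℝ)| ≤ 1 := by
      by_contra! hlt
      nlinarith
    exact_mod_cast this
  obtain ⟨hn2, hn3⟩ := abs_le.1 hn1
  obtain ⟨ha1, ha2⟩ := abs_le.1 ha
  obtain ⟨hb1, hb2⟩ := abs_le.1 hb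
  interval_cases n
  · right
    push_cast at h1
    have : a = -Real.pi := by linarith
    refine ⟨by rw [this, abs_neg, abs_of_pos hpi], by linarith⟩
  · left
    push_cast at h1
    linarith
  · right
    push_cast at h1
    have : a = Real.pi := by linarith
    refine ⟨by rw [this, abs_of_pos hpi], by linarith⟩

lemma abs_polar_le {t : ℝ} (ht : t ∈ Icc (0 : ℝ) 1) : |2 * Real.pi * t - Real.pi| ≤ Real.pi := by
  have hpi := Real.pi_pos
  obtain ⟨h0, h1⟩ := ht
  rw [abs_le]
  constructor <;> nlinarith

lemma polarCurve_closed {u : ℝ → ℝ} (hu : u Real.pi = u (-Real.pi)) :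
    polarCurve u 0 = polarCurve u 1 := by
  rw [polarCurve, polarCurve, Complex.exp_eq_exp_iff_exists_int]
  refine ⟨-1, ?_⟩
  have h1 : 2 * Real.pi * 0 - Real.pi = -Real.pi := by ring
  have h2 : 2 * Real.pi * 1 - Real.pi = Real.pi := by ring
  rw [h1, h2, hu]
  push_cast
  ring

lemma polarCurve_injOn (u : ℝ → ℝ) : InjOn (polarCurve u) (Ico 0 1) := by
  intro t ht t' ht' h
  have hpi := Real.pi_pos
  obtain ⟨-, h1 | ⟨h1, h2⟩⟩ := exp_polar_eq (abs_polar_le (Ico_subset_Icc_self ht))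
    (abs_polar_le (Ico_subset_Icc_self ht')) h
  · have : 2 * Real.pi * (t - t') = 0 := by linarith
    rcases mul_eq_zero.1 this with h3 | h3 <;> linarith
  -- Opposite angles of modulus `π` force one of the two parameters to be `1`, which the half-open
  -- interval excludes.
  · have h3 : 2 * Real.pi * (t + t' - 1) = 0 := by linarith
    have h4 : t + t' = 1 := by
      rcases mul_eq_zero.1 h3 with h3 | h3 <;> linarith
    rcases (abs_eq hpi.le).1 h1 with h5 | h5
    · have : 2 * Real.pi * (t - 1) = 0 := by linarith
      rcases mul_eq_zero.1 this with h3 | h3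
      · linarith
      · linarith [ht.2]
    · have : 2 * Real.pi * t = 0 := by linarith
      rcases mul_eq_zero.1 this with h3 | h3
      · linarith
      · linarith [ht'.2]

/-- The exponent `u(θ) + iθ` is a continuous logarithm along the curve, and its end values differ by
`2πi`. -/
lemma polarCurve_winding_zero {u : ℝ → ℝ} (hu : ContDiff ℝ 1 u) (hu' : u Real.pi = u (-Real.pi)) :
    curveIntegral (polarCurve u) (fun s => s⁻¹) = 2 * Real.pi * Complex.I := by
  have hud : Continuous (deriv u) := hu.continuous_deriv le_rfl
  set θ : ℝ → ℝ := fun t => 2 * Real.pi * t - Real.pi with hθ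
  have hθd : ∀ t, HasDerivAt θ (2 * Real.pi) t := fun t => by
    exact (((hasDerivAt_id t).const_mul (2 * Real.pi)).sub_const Real.pi).congr_deriv (mul_one _)
  have hL : ∀ t, HasDerivAt (fun t => ((u (θ t) : ℝ) : ℂ) + (θ t : ℝ) * Complex.I)
      (((deriv u (θ t) * (2 * Real.pi) : ℝ) : ℂ) + ((2 * Real.pi : ℝ) : ℂ) * Complex.I) t := by
    intro t
    have h1 : HasDerivAt (fun t => u (θ t)) (deriv u (θ t) * (2 * Real.pi)) t :=
      ((hu.differentiable one_ne_zero (θ t)).hasDerivAt).comp_of_eq t (hθd t) rfl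
    exact h1.ofReal_comp.add ((hθd t).ofReal_comp.mul_const _)
  rw [curveIntegral]
  have h1 : ∀ t, (polarCurve u t)⁻¹ * deriv (polarCurve u) t =
      ((deriv u (θ t) * (2 * Real.pi) : ℝ) : ℂ) + ((2 * Real.pi : ℝ) : ℂ) * Complex.I := by
    intro t
    have h2 : deriv (polarCurve u) t = polarCurve u t * _ := (hL t).cexp.deriv
    rw [h2, inv_mul_cancel_left₀ (show polarCurve u t ≠ 0 from Complex.exp_ne_zero _)]
  simp only [h1]
  rw [intervalIntegral.integral_eq_sub_of_hasDerivAt (fun t _ => hL t)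
    (Continuous.intervalIntegrable (by fun_prop) _ _)]
  have h2 : θ 1 = Real.pi := by simp only [hθ]; ring
  have h3 : θ 0 = -Real.pi := by simp only [hθ]; ring
  rw [h2, h3, hu']
  push_cast
  ring

/-- The curve does not meet the segments from `0` to the points that it encloses. -/
lemma polarCurve_ne {u : ℝ → ℝ} (hu' : ∀ θ, u (-θ) = u θ) {v a : ℝ} (ha : |a| ≤ Real.pi)
    (hv : v < u a) {l : ℝ} (hl : l ∈ Icc (0 : ℝ) 1) {t : ℝ} (ht : t ∈ Icc (0 : ℝ) 1) :
    polarCurve u t ≠ l * Complex.exp ((v : ℂ) + a * Complex.I) := by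
  intro h
  rcases hl.1.eq_or_lt with rfl | hl0
  · simp [polarCurve] at h
  have h1 : (l : ℂ) * Complex.exp ((v : ℂ) + a * Complex.I) =
      Complex.exp (((Real.log l + v : ℝ) : ℂ) + a * Complex.I) := by
    rw [Complex.ofReal_add, add_assoc, Complex.exp_add (Real.log l : ℂ), ← Complex.ofReal_exp,
      Real.exp_log hl0]
  rw [h1] at h
  obtain ⟨h2, h3⟩ := exp_polar_eq (abs_polar_le ht) ha h
  have h4 : u (2 * Real.pi * t - Real.pi) = u a := by
    rcases h3 with h3 | ⟨-, h3⟩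
    · rw [h3]
    · rw [h3, hu']
  have := Real.log_nonpos hl.1 hl.2
  linarith

/-- The absolute values absorb the endpoint `a = -π`, where the principal argument is `π`. -/
lemma abs_arg_exp {x a : ℝ} (ha : |a| ≤ Real.pi) :
    |(Complex.exp ((x : ℂ) + a * Complex.I)).arg| = |a| := by
  obtain ⟨h1, h2⟩ := abs_le.1 ha
  rw [Complex.exp_add, ← Complex.ofReal_exp, Complex.arg_real_mul _ (Real.exp_pos x)]
  rcases h1.eq_or_lt with h | h
  · rw [← h]
    simp only [Complex.ofReal_neg, neg_mul, Complex.exp_neg, Complex.exp_pi_mul_I]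
    norm_num
  · rw [Complex.exp_mul_I, Complex.arg_cos_add_sin_mul_I ⟨h, h2⟩]

/-! ### Angular regions -/

/-- Cosine is strictly decreasing on `[0, π]`. The right-hand side is continuous in `z`, so openness
of angular regions can be read off despite the jump of `arg` on the negative axis. -/
lemma lt_abs_arg_iff {z : ℂ} (hz : z ≠ 0) {p : ℝ} (h0 : 0 ≤ p) (hp : p ≤ Real.pi) :
    p < |z.arg| ↔ z.re < Real.cos p * ‖z‖ := by
  rw [← Real.strictAntiOn_cos.lt_iff_gt ⟨abs_nonneg _, Complex.abs_arg_le_pi z⟩ ⟨h0, hp⟩,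
    Real.cos_abs, Complex.cos_arg hz, div_lt_iff₀ (norm_pos_iff.2 hz)]

lemma abs_arg_lt_iff {z : ℂ} (hz : z ≠ 0) {p : ℝ} (h0 : 0 ≤ p) (hp : p ≤ Real.pi) :
    |z.arg| < p ↔ Real.cos p * ‖z‖ < z.re := by
  rw [← Real.strictAntiOn_cos.lt_iff_gt ⟨h0, hp⟩ ⟨abs_nonneg _, Complex.abs_arg_le_pi z⟩,
    Real.cos_abs, Complex.cos_arg hz, lt_div_iff₀ (norm_pos_iff.2 hz)]

lemma three_pi_div_four_mem : 0 ≤ 3 * Real.pi / 4 ∧ 3 * Real.pi / 4 ≤ Real.pi :=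
  ⟨by positivity, by linarith [Real.pi_pos]⟩

lemma isOpen_leftAngularDomain (h : ℝ) : IsOpen (leftAngularDomain h) := by
  have : {s : ℂ | s ≠ 0 ∧ 3 * Real.pi / 4 < |s.arg|} =
      {s : ℂ | s ≠ 0} ∩ {s : ℂ | s.re < Real.cos (3 * Real.pi / 4) * ‖s‖} := by
    ext s
    refine and_congr_right fun hs => ?_
    exact lt_abs_arg_iff hs three_pi_div_four_mem.1 three_pi_div_four_mem.2
  rw [leftAngularDomain, this]
  refine (IsOpen.inter isOpen_ne ?_).union Metric.isOpen_ball
  exact isOpen_lt Complex.continuous_re (by fun_prop)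

lemma isOpen_angularRegion {ψ : ℝ} (hψ : 3 * Real.pi / 4 < ψ) (hψ' : ψ ≤ Real.pi) :
    IsOpen (angularRegion ψ) := by
  have hpi := Real.pi_pos
  have : angularRegion ψ =
      {z : ℂ | z ≠ 0} ∩ {z : ℂ | Real.cos (ψ - Real.pi / 2) * ‖z‖ < z.re} := by
    ext z
    refine and_congr_right fun hz => ?_
    exact abs_arg_lt_iff hz (by linarith) (by linarith)
  rw [this]
  exact IsOpen.inter isOpen_ne (isOpen_lt (by fun_prop) Complex.continuous_re)

lemma leftAngularDomain_subset_slitDomain {h : ℝ} : leftAngularDomain h ⊆ slitDomain h := by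
  rintro s (⟨hs0, hs⟩ | hs) ⟨h1, h2⟩
  · have := Complex.abs_arg_le_pi_div_two_iff.2 h1
    linarith [Real.pi_pos]
  · have h3 : ‖s‖ < Real.sqrt (h - 1) := by simpa using hs
    linarith [Complex.abs_im_le_norm s]

/-! ### The truncated contour and a curve around it -/

/-- The trace of the part `|s| ≤ r` of the angular contour, in the variable `w = log s`. -/
def contourLog (δ ψ r : ℝ) : Set ℂ :=
  {w : ℂ | Real.log δ ≤ w.re ∧ w.re ≤ Real.log r ∧ |w.im| ≤ ψ ∧
    (w.re = Real.log δ ∨ |w.im| = ψ)}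

/-- The trace of the part `|s| ≤ r` of the angular contour. -/
def contourSet (δ ψ r : ℝ) : Set ℂ := Complex.exp '' contourLog δ ψ r

lemma isCompact_contourSet (δ ψ r : ℝ) : IsCompact (contourSet δ ψ r) := by
  refine IsCompact.image ?_ Complex.continuous_exp
  have h1 : IsClosed (contourLog δ ψ r) := by
    refine (isClosed_le continuous_const Complex.continuous_re).inter
      ((isClosed_le Complex.continuous_re continuous_const).inter
      ((isClosed_le (Complex.continuous_im.abs) continuous_const).inter
      (IsClosed.union (isClosed_eq Complex.continuous_re continuous_const)
        (isClosed_eq (Complex.continuous_im.abs) continuous_const))))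
  refine (isCompact_Icc.reProdIm isCompact_Icc :
    IsCompact (Icc (Real.log δ) (Real.log r) ×ℂ Icc (-ψ) ψ)).of_isClosed_subset h1 ?_
  rintro w ⟨h1, h2, h3, -⟩
  exact ⟨⟨h1, h2⟩, abs_le.1 h3⟩

lemma norm_exp_eq (w : ℂ) : ‖Complex.exp w‖ = Real.exp w.re := Complex.norm_exp w

lemma contourSet_subset {h δ ψ r : ℝ} (hψ : 3 * Real.pi / 4 < ψ) (hψ' : ψ ≤ Real.pi)
    (hδ : 0 < δ) (hδ' : δ < Real.sqrt (h - 1)) :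
    contourSet δ ψ r ⊆ leftAngularDomain h := by
  rintro _ ⟨w, ⟨-, -, h3, h4⟩, rfl⟩
  rcases h4 with h4 | h4
  · right
    simpa [norm_exp_eq, h4, Real.exp_log hδ] using hδ'
  · left
    refine ⟨Complex.exp_ne_zero _, ?_⟩
    rw [← Complex.re_add_im w, abs_arg_exp (h3.trans hψ'), h4]
    exact hψ

/-- Provides the logarithmic radius of the enclosing curve: below `b` for `|θ| ≤ p`, so that the
curve stays in the disc there, and above `L` at `|θ| = ψ`, so that it passes beyond the ends of the
rays. With `A` strictly between `p` and `ψ` and `m` the midpoint of `a` and `b`, the function `m +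
(θ/A)^{2N}` does this for large `N`; being even, it closes up at `±π`. -/
lemma exists_radius {p ψ a b : ℝ} (hp : 0 < p) (hpψ : p < ψ) (hab : a < b) (L : ℝ) :
    ∃ u : ℝ → ℝ, ContDiff ℝ 1 u ∧ (∀ θ, u (-θ) = u θ) ∧ (∀ θ, a < u θ) ∧
      (∀ θ, |θ| ≤ p → u θ < b) ∧ (∀ θ, |θ| = ψ → L < u θ) := by
  set A := (p + ψ) / 2 with hA
  have hA0 : 0 < A := by rw [hA]; linarith
  set m := (a + b) / 2 with hm
  have h1 : (p / A) ^ 2 < 1 := by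
    have : p / A < 1 := (div_lt_one hA0).2 (by rw [hA]; linarith)
    exact pow_lt_one₀ (by positivity) this two_ne_zero
  have h2 : 1 < (ψ / A) ^ 2 := by
    have : 1 < ψ / A := (one_lt_div hA0).2 (by rw [hA]; linarith)
    exact one_lt_pow₀ this two_ne_zero
  have e1 := (tendsto_pow_atTop_nhds_zero_of_lt_one (by positivity) h1).eventually
    (gt_mem_nhds (show 0 < b - m by rw [hm]; linarith))
  have e2 := (tendsto_pow_atTop_atTop_of_one_lt h2).eventually (eventually_gt_atTop (L - m))
  obtain ⟨N, hN1, hN2⟩ := (e1.and e2).exists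
  refine ⟨fun θ => m + ((θ / A) ^ 2) ^ N, by fun_prop, fun θ => ?_, fun θ => ?_, fun θ hθ => ?_,
    fun θ hθ => ?_⟩
  · simp only [neg_div, neg_sq]
  · have : 0 ≤ ((θ / A) ^ 2) ^ N := by positivity
    simp only [hm] at *
    linarith
  · have : ((θ / A) ^ 2) ^ N ≤ ((p / A) ^ 2) ^ N := by
      refine pow_le_pow_left₀ (by positivity) ?_ _
      rw [← sq_abs (θ / A), abs_div, abs_of_pos hA0]
      gcongr
    linarith
  · have : (θ / A) ^ 2 = (ψ / A) ^ 2 := by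
      rw [← sq_abs (θ / A), abs_div, abs_of_pos hA0, hθ]
    simp only [this]
    linarith

/-- There is a smooth simple closed curve in the left angular domain that encloses the truncated
contour, and Cauchy's formula holds for it. -/
lemma exists_enclosingCurve {h δ ψ : ℝ} (r : ℝ) (hψ : 3 * Real.pi / 4 < ψ) (hψ' : ψ ≤ Real.pi)
    (hδ : 0 < δ) (hδ' : δ < Real.sqrt (h - 1)) :
    ∃ γ : ℝ → ℂ, ContDiff ℝ 1 γ ∧
      IsEnclosingCurve (leftAngularDomain h) (contourSet δ ψ r) γ ∧
      ∀ f : ℂ → ℂ, DifferentiableOn ℂ f (leftAngularDomain h) → ∀ w ∈ contourSet δ ψ r,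
        curveIntegral γ (fun s => f s / (s - w)) = 2 * Real.pi * Complex.I * f w := by
  have hR : 0 < Real.sqrt (h - 1) := hδ.trans hδ'
  obtain ⟨u, hu, heven, hu1, hu2, hu3⟩ := exists_radius (a := Real.log δ)
    (b := Real.log (Real.sqrt (h - 1))) (p := 3 * Real.pi / 4) (by positivity) hψ
    (Real.log_lt_log hδ hδ') (Real.log r)
  have hc := polarCurve_contDiff hu
  have hclosed := polarCurve_closed (heven Real.pi).symm
  have hne : ∀ w ∈ contourSet δ ψ r, ∀ l ∈ Icc (0 : ℝ) 1, ∀ t ∈ Icc (0 : ℝ) 1,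
      polarCurve u t ≠ l * w := by
    rintro _ ⟨w, ⟨h1, h2, h3, h4⟩, rfl⟩ l hl t ht
    rw [← Complex.re_add_im w]
    refine polarCurve_ne heven (h3.trans hψ') ?_ hl ht
    rcases h4 with h4 | h4
    · rw [h4]; exact hu1 _
    · exact h2.trans_lt (hu3 _ h4)
  -- Radial contraction stays in the domain: for `|θ| ≤ 3π/4` the curve lies in the disc, and
  -- elsewhere scaling by `l > 0` preserves the argument.
  have hstar : ∀ l ∈ Icc (0 : ℝ) 1, ∀ t ∈ Icc (0 : ℝ) 1,
      (l : ℂ) * polarCurve u t ∈ leftAngularDomain h := by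
    intro l hl t ht
    rcases hl.1.eq_or_lt with rfl | hl0
    · right
      simpa using hR
    rcases le_or_gt |2 * Real.pi * t - Real.pi| (3 * Real.pi / 4) with h1 | h1
    · right
      have h2 := (Real.lt_log_iff_exp_lt hR).1 (hu2 _ h1)
      rw [mem_ball_zero_iff, norm_mul, polarCurve, norm_exp_eq, Complex.norm_real, Real.norm_eq_abs,
        abs_of_pos hl0]
      have h3 : ((u (2 * Real.pi * t - Real.pi) : ℂ) +
        (2 * Real.pi * t - Real.pi : ℝ) * Complex.I).re = u (2 * Real.pi * t - Real.pi) := by simp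
      rw [h3]
      exact (mul_le_of_le_one_left (Real.exp_pos _).le hl.2).trans_lt h2
    · left
      refine ⟨mul_ne_zero (by exact_mod_cast hl0.ne') (Complex.exp_ne_zero _), ?_⟩
      rw [Complex.arg_real_mul _ hl0, polarCurve, abs_arg_exp (abs_polar_le ht)]
      exact h1
  have hne1 : ∀ w ∈ contourSet δ ψ r, ∀ t ∈ Icc (0 : ℝ) 1, polarCurve u t ≠ w := by
    intro w hw t ht
    simpa using hne w hw 1 (by simp) t ht
  have hwind : ∀ w ∈ contourSet δ ψ r,
      curveIntegral (polarCurve u) (fun s => (s - w)⁻¹) = 2 * Real.pi * Complex.I := by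
    intro w hw
    rw [curveIntegral_sub_inv_eq hc hclosed (hne w hw),
      polarCurve_winding_zero hu (heven Real.pi).symm]
  refine ⟨polarCurve u, hc, ⟨?_, hclosed, polarCurve_injOn u, ?_, hwind⟩, ?_⟩
  · obtain ⟨C, hC⟩ := isCompact_Icc.exists_bound_of_continuousOn (s := Icc (0 : ℝ) 1)
      (hc.continuous_deriv le_rfl).continuousOn
    refine ⟨C.toNNReal, (convex_Icc 0 1).lipschitzOnWith_of_nnnorm_deriv_le
      (fun t _ => hc.differentiable one_ne_zero t) fun t ht => ?_⟩
    rw [← NNReal.coe_le_coe, coe_nnnorm]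
    exact (hC t ht).trans (Real.le_coe_toNNReal C)
  · intro t ht
    exact ⟨by simpa using hstar 1 (by simp) t ht, fun hK => hne1 _ hK t ht rfl⟩
  · intro f hf w hw
    exact curveIntegral_div_sub (isOpen_leftAngularDomain h) hf hc hclosed hstar
      (contourSet_subset hψ hψ' hδ hδ' hw) (hne1 w hw) (hwind w hw)

/-! ### Contour integrals of exponentials with bounded coefficients -/

/-- The integrand `e^{sz} C(log s)` at `s = e^w`. -/
def expKernel (C : ℂ → ℂ) (z w : ℂ) : ℂ := Complex.exp (Complex.exp w * z) * C w

/-- The arc and the two closed sectors adjacent to the contours of half-opening between `3π/4`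
and `ψ`, in the variable `w = log s`. -/
def coeffRegion (δ ψ : ℝ) : Set ℂ :=
  {w : ℂ | Real.log δ ≤ w.re ∧ |w.im| ≤ ψ ∧ (w.re = Real.log δ ∨ 3 * Real.pi / 4 ≤ |w.im|)}

/-- `C` is continuous and bounded by `M` on the contours of half-opening between `3π/4` and `ψ`. -/
structure IsCoeff (δ ψ M : ℝ) (C : ℂ → ℂ) : Prop where
  continuousOn : ContinuousOn C (coeffRegion δ ψ)
  bound : ∀ w ∈ coeffRegion δ ψ, ‖C w‖ ≤ M

lemma IsCoeff.mono {δ ψ ψ' M : ℝ} {C : ℂ → ℂ} (hC : IsCoeff δ ψ M C) (h : ψ' ≤ ψ) :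
    IsCoeff δ ψ' M C := by
  have : coeffRegion δ ψ' ⊆ coeffRegion δ ψ := fun w hw => ⟨hw.1, hw.2.1.trans h, hw.2.2⟩
  exact ⟨hC.continuousOn.mono this, fun w hw => hC.bound w (this hw)⟩

lemma polarLog_re (t θ : ℝ) : (polarLog t θ).re = Real.log t := by simp [polarLog]

lemma polarLog_im (t θ : ℝ) : (polarLog t θ).im = θ := by simp [polarLog]

lemma exp_polarLog {t : ℝ} (ht : 0 < t) (θ : ℝ) :
    Complex.exp (polarLog t θ) = t * Complex.exp (θ * Complex.I) := by
  rw [polarLog, Complex.exp_add, ← Complex.ofReal_exp, Real.exp_log ht]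

lemma continuousOn_polarLog {δ : ℝ} (hδ : 0 < δ) (θ : ℝ) :
    ContinuousOn (fun t => polarLog t θ) (Ici δ) := by
  have h1 : ContinuousOn Real.log (Ici δ) :=
    Real.continuousOn_log.mono fun t ht => (hδ.trans_le ht).ne'
  exact (Complex.continuous_ofReal.comp_continuousOn h1).add continuousOn_const

lemma arc_mem_coeffRegion {δ ψ θ : ℝ} (hθ : |θ| ≤ ψ) : polarLog δ θ ∈ coeffRegion δ ψ :=
  ⟨by rw [polarLog_re], by rwa [polarLog_im], Or.inl (polarLog_re _ _)⟩

lemma ray_mem_coeffRegion {δ ψ θ t : ℝ} (hδ : 0 < δ) (hθ : |θ| ≤ ψ) (hθ' : 3 * Real.pi / 4 ≤ |θ|)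
    (ht : δ ≤ t) : polarLog t θ ∈ coeffRegion δ ψ :=
  ⟨by rw [polarLog_re]; exact Real.log_le_log hδ ht, by rwa [polarLog_im],
    Or.inr (by rwa [polarLog_im])⟩

/-- `∫ H ds / 2πi` over the part `δ ≤ |s| ≤ r` of the ray `arg s = θ`, outwards. -/
def rayIntegral (δ r θ : ℝ) (H : ℂ → ℂ) : ℂ :=
  (2 * Real.pi * Complex.I)⁻¹ *
    ∫ t in δ..r, H (polarLog t θ) * Complex.exp (θ * Complex.I)

/-- `∫ H ds / 2πi` over the part `|s| ≥ δ` of the ray `arg s = θ`, outwards. -/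
def rayIntegralInfty (δ θ : ℝ) (H : ℂ → ℂ) : ℂ :=
  (2 * Real.pi * Complex.I)⁻¹ *
    ∫ t in Ioi δ, H (polarLog t θ) * Complex.exp (θ * Complex.I)

lemma truncatedIntegral_eq (δ ψ r : ℝ) (H : ℂ → ℂ) :
    truncatedIntegral δ ψ r H =
      arcIntegral δ ψ H + rayIntegral δ r ψ H - rayIntegral δ r (-ψ) H := by
  simp only [truncatedIntegral, rayIntegral, Complex.ofReal_neg]
  ring

lemma angularIntegral_eq (δ ψ : ℝ) (H : ℂ → ℂ) :
    angularIntegral δ ψ H =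
      arcIntegral δ ψ H + rayIntegralInfty δ ψ H - rayIntegralInfty δ (-ψ) H := by
  simp only [angularIntegral, rayIntegralInfty, Complex.ofReal_neg]
  ring

lemma CompactConv.tendsto {u : ℝ → ℂ → ℂ} {v : ℂ → ℂ} {D : Set ℂ} (h : CompactConv u v D) {z : ℂ}
    (hz : z ∈ D) : Tendsto (fun r => u r z) atTop (𝓝 (v z)) :=
  (h {z} (singleton_subset_iff.2 hz) isCompact_singleton).tendsto_at rfl

lemma norm_two_pi_I_inv_le : ‖(2 * Real.pi * Complex.I : ℂ)⁻¹‖ ≤ 1 := by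
  rw [norm_inv]
  refine inv_le_one_of_one_le₀ ?_
  simp only [norm_mul, Complex.norm_I, Complex.norm_real, Complex.norm_ofNat, Real.norm_eq_abs,
    abs_of_pos Real.pi_pos, mul_one]
  linarith [Real.pi_gt_three]

/-- The real part is `‖z‖ cos(θ + arg z)`. The half-opening `ψ - π/2` is what places `θ + arg z`, up
to sign, between `π/2` and `3π/2`. -/
lemma angularRegion_re_neg {ψ θ : ℝ} (hθ : ψ ≤ |θ|)
    (hθ' : |θ| ≤ Real.pi) {z : ℂ} (hz : z ∈ angularRegion ψ) :
    (Complex.exp (θ * Complex.I) * z).re < 0 := by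
  obtain ⟨hz0, hz⟩ := hz
  have hpi := Real.pi_pos
  have key : ∀ a : ℝ, ψ ≤ a → a ≤ Real.pi → ∀ b : ℝ, |b| < ψ - Real.pi / 2 →
      Real.cos (a + b) < 0 := by
    intro a h1 h2 b hb
    obtain ⟨hb1, hb2⟩ := abs_lt.1 hb
    exact Real.cos_neg_of_pi_div_two_lt_of_lt (by linarith) (by linarith)
  have h1 : (Complex.exp (θ * Complex.I) * z).re = ‖z‖ * Real.cos (θ + z.arg) := by
    conv_lhs => rw [← Complex.norm_mul_exp_arg_mul_I z]
    rw [mul_left_comm, ← Complex.exp_add, ← add_mul, ← Complex.ofReal_add, Complex.re_ofReal_mul,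
      Complex.exp_ofReal_mul_I_re]
  rw [h1]
  refine mul_neg_of_pos_of_neg (norm_pos_iff.2 hz0) ?_
  rcases abs_cases θ with ⟨h2, -⟩ | ⟨h2, -⟩
  · exact key θ (h2 ▸ hθ) (h2 ▸ hθ') _ hz
  · have := key (-θ) (h2 ▸ hθ) (h2 ▸ hθ') (-z.arg) (by rwa [abs_neg])
    rwa [← neg_add, Real.cos_neg] at this

namespace IsCoeff

variable {δ ψ M : ℝ} {C : ℂ → ℂ}

lemma continuousOn_ray (hC : IsCoeff δ ψ M C) (hδ : 0 < δ) {θ : ℝ} (hθ : |θ| ≤ ψ)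
    (hθ' : 3 * Real.pi / 4 ≤ |θ|) : ContinuousOn (fun t => C (polarLog t θ)) (Ici δ) :=
  hC.continuousOn.comp (continuousOn_polarLog hδ θ)
    fun _ ht => ray_mem_coeffRegion hδ hθ hθ' ht

lemma continuousOn_ray_expKernel (hC : IsCoeff δ ψ M C) (hδ : 0 < δ) {θ : ℝ} (hθ : |θ| ≤ ψ)
    (hθ' : 3 * Real.pi / 4 ≤ |θ|) (z : ℂ) :
    ContinuousOn (fun t => expKernel C z (polarLog t θ)) (Ici δ) := by
  have := continuousOn_polarLog hδ θ
  exact ((this.cexp.mul continuousOn_const).cexp).mul (hC.continuousOn_ray hδ hθ hθ')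

lemma norm_expKernel_le (hC : IsCoeff δ ψ M C) (hδ : 0 < δ) {θ : ℝ} (hθ : |θ| ≤ ψ)
    (hθ' : 3 * Real.pi / 4 ≤ |θ|) {z : ℂ} {c : ℝ}
    (hz : (Complex.exp (θ * Complex.I) * z).re ≤ -c) {t : ℝ} (ht : δ ≤ t) :
    ‖expKernel C z (polarLog t θ)‖ ≤ M * Real.exp (-c * t) := by
  have ht0 : 0 < t := hδ.trans_le ht
  rw [expKernel, norm_mul, mul_comm, exp_polarLog ht0, mul_assoc, Complex.norm_exp,
    Complex.re_ofReal_mul]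
  refine mul_le_mul (hC.bound _ (ray_mem_coeffRegion hδ hθ hθ' ht)) (Real.exp_le_exp.2 ?_)
    (Real.exp_pos _).le ((norm_nonneg _).trans (hC.bound _ (ray_mem_coeffRegion hδ hθ hθ' ht)))
  nlinarith

lemma integrableOn_ray (hC : IsCoeff δ ψ M C) (hδ : 0 < δ) {θ : ℝ} (hθ : |θ| ≤ ψ)
    (hθ' : 3 * Real.pi / 4 ≤ |θ|) {z : ℂ} (hz : (Complex.exp (θ * Complex.I) * z).re < 0) :
    IntegrableOn (fun t => expKernel C z (polarLog t θ)) (Ioi δ) := by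
  refine Integrable.mono' ((integrableOn_exp_mul_Ioi hz δ).const_mul M)
    (((hC.continuousOn_ray_expKernel hδ hθ hθ' z).mono Ioi_subset_Ici_self).aestronglyMeasurable
      measurableSet_Ioi) ?_
  filter_upwards [ae_restrict_mem measurableSet_Ioi] with t ht
  have := hC.norm_expKernel_le hδ hθ hθ' (z := z) (neg_neg _).ge (le_of_lt ht)
  rwa [neg_neg] at this

/-- The tail beyond `r` is dominated by the integral of `M e^{-ct}`; the bound depends on `z` only
through `c`. -/
lemma norm_ray_tail_le (hC : IsCoeff δ ψ M C) (hδ : 0 < δ) {θ : ℝ} (hθ : |θ| ≤ ψ)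
    (hθ' : 3 * Real.pi / 4 ≤ |θ|) {z : ℂ} {c : ℝ} (hc : 0 < c)
    (hz : (Complex.exp (θ * Complex.I) * z).re ≤ -c) {r : ℝ} (hr : δ ≤ r) :
    ‖rayIntegralInfty δ θ (expKernel C z) - rayIntegral δ r θ (expKernel C z)‖ ≤
      M * Real.exp (-c * r) / c := by
  have hz' : (Complex.exp (θ * Complex.I) * z).re < 0 := by linarith
  have hi : IntegrableOn (fun t => expKernel C z (polarLog t θ) * Complex.exp (θ * Complex.I))
      (Ioi δ) := (hC.integrableOn_ray hδ hθ hθ' hz').mul_const _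
  rw [rayIntegralInfty, rayIntegral, ← mul_sub,
    ← intervalIntegral.integral_interval_add_Ioi hi (hi.mono_set (Ioi_subset_Ioi hr)),
    add_sub_cancel_left, norm_mul]
  have hM : 0 ≤ M := (norm_nonneg _).trans (hC.bound _ (ray_mem_coeffRegion hδ hθ hθ' le_rfl))
  have h2 : ‖∫ t in Ioi r, expKernel C z (polarLog t θ) * Complex.exp (θ * Complex.I)‖ ≤
      ∫ t in Ioi r, M * Real.exp (-c * t) := by
    refine norm_integral_le_of_norm_le
      ((integrableOn_exp_mul_Ioi (by linarith : -c < 0) r).const_mul M) ?_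
    filter_upwards [ae_restrict_mem measurableSet_Ioi] with t ht
    rw [norm_mul, Complex.norm_exp_ofReal_mul_I, mul_one]
    exact hC.norm_expKernel_le hδ hθ hθ' hz (hr.trans (le_of_lt ht))
  rw [integral_const_mul, integral_exp_mul_Ioi (by linarith), neg_div_neg_eq, ← mul_div_assoc] at h2
  exact (mul_le_of_le_one_left (norm_nonneg _) norm_two_pi_I_inv_le).trans h2

lemma angularIntegrable (hC : IsCoeff δ ψ M C) (hδ : 0 < δ) (hψ : 3 * Real.pi / 4 < ψ)
    (hψ' : ψ ≤ Real.pi) {z : ℂ} (hz : z ∈ angularRegion ψ) :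
    AngularIntegrable δ ψ (expKernel C z) := by
  have hψ0 : 0 < ψ := lt_trans (by positivity) hψ
  have ha : |ψ| = ψ := abs_of_pos hψ0
  have ha' : |-ψ| = ψ := by rw [abs_neg, ha]
  refine ⟨ContinuousOn.intervalIntegrable ?_,
    hC.integrableOn_ray hδ ha.le (by rw [ha]; exact hψ.le)
      (angularRegion_re_neg ha.ge (by rwa [ha]) hz),
    hC.integrableOn_ray hδ ha'.le (by rw [ha']; exact hψ.le)
      (angularRegion_re_neg ha'.ge (by rwa [ha']) hz)⟩
  rw [uIcc_of_le (by linarith)]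
  have hp : Continuous fun θ : ℝ => polarLog δ θ := by unfold polarLog; fun_prop
  have h2 : ContinuousOn (fun θ : ℝ => C (polarLog δ θ)) (Icc (-ψ) ψ) :=
    hC.continuousOn.comp hp.continuousOn fun θ hθ => arc_mem_coeffRegion (abs_le.2 hθ)
  exact ((hp.cexp.mul continuous_const).cexp.continuousOn).mul h2

/-- The arc is common to both integrals, so only the tails of the two rays matter. Compactness of
`K` supplies one decay rate `c` for each ray. -/
lemma compactConv (hC : IsCoeff δ ψ M C) (hδ : 0 < δ) (hψ : 3 * Real.pi / 4 < ψ)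
    (hψ' : ψ ≤ Real.pi) :
    CompactConv (fun r z => truncatedIntegral δ ψ r (expKernel C z))
      (fun z => angularIntegral δ ψ (expKernel C z)) (angularRegion ψ) := by
  intro K hK hKc
  have hψ0 : 0 < ψ := lt_trans (by positivity) hψ
  have ha : |ψ| = ψ := abs_of_pos hψ0
  have ha' : |-ψ| = ψ := by rw [abs_neg, ha]
  have hneg : ∀ θ : ℝ, |θ| = ψ → ∃ c > 0, ∀ z ∈ K, (Complex.exp (θ * Complex.I) * z).re ≤ -c := by
    intro θ hθ
    have hcont : ContinuousOn (fun z : ℂ => -(Complex.exp (θ * Complex.I) * z).re) K := by fun_prop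
    obtain ⟨c, hc, h⟩ := hKc.exists_forall_le' hcont (a := 0) fun z hz =>
      neg_pos.2 (angularRegion_re_neg hθ.ge (hθ ▸ hψ') (hK hz))
    exact ⟨c, hc, fun z hz => by linarith [h z hz]⟩
  obtain ⟨c₁, hc₁, h₁⟩ := hneg ψ ha
  obtain ⟨c₂, hc₂, h₂⟩ := hneg (-ψ) ha'
  have hlim : ∀ c > 0, Tendsto (fun r : ℝ => M * Real.exp (-c * r) / c) atTop (𝓝 0) := by
    intro c hc
    have : Tendsto (fun r : ℝ => Real.exp (-c * r)) atTop (𝓝 0) :=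
      Real.tendsto_exp_atBot.comp (tendsto_id.const_mul_atTop_of_neg (by linarith))
    simpa using (this.const_mul M).div_const c
  have hlim2 := (hlim c₁ hc₁).add (hlim c₂ hc₂)
  rw [add_zero] at hlim2
  rw [Metric.tendstoUniformlyOn_iff]
  intro ε hε
  filter_upwards [hlim2.eventually (gt_mem_nhds hε), eventually_ge_atTop δ] with r hr hrδ z hz
  refine lt_of_le_of_lt ?_ hr
  rw [dist_eq_norm, angularIntegral_eq, truncatedIntegral_eq]
  refine le_trans (le_of_eq (congrArg norm ?_)) ((norm_sub_le _ _).trans (add_le_add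
    (hC.norm_ray_tail_le hδ ha.le (by rw [ha]; exact hψ.le) hc₁ (h₁ z hz) hrδ)
    (hC.norm_ray_tail_le hδ ha'.le (by rw [ha']; exact hψ.le) hc₂ (h₂ z hz) hrδ)))
  ring

end IsCoeff

/-! ### Truncated integrals as superpositions of exponentials -/

/-- `φ` is an entire function of exponential type whose Borel transform continues to `Kᶜ`, and the
integral over `γ` defining the action of the symbol `k` on `φ` is `u`. -/
def ActsAs (K : Set ℂ) (γ : ℝ → ℂ) (k φ u : ℂ → ℂ) : Prop :=
  ∃ B : ℂ → ℂ, IsBorelContinuation φ K B ∧ Differentiable ℂ φ ∧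
    (∃ C τ : ℝ, 0 ≤ C ∧ 0 ≤ τ ∧ ∀ z : ℂ, ‖φ z‖ ≤ C * Real.exp (τ * ‖z‖)) ∧
    ∀ z : ℂ, IntervalIntegrable
      (fun t => Complex.exp (γ t * z) * k (γ t) * B (γ t) * deriv γ t) volume 0 1 ∧
      curveIntegral γ (fun s => Complex.exp (s * z) * k s * B s) = 2 * Real.pi * Complex.I * u z

/-- The integrability clause of `ActsAs` allows the integrals over `γ` to be added; the sign
conditions on `C` and `τ` allow the growth bounds to be merged. -/
lemma ActsAs.add {K : Set ℂ} {γ : ℝ → ℂ} {k φ₁ u₁ φ₂ u₂ : ℂ → ℂ} (h₁ : ActsAs K γ k φ₁ u₁)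
    (h₂ : ActsAs K γ k φ₂ u₂) : ActsAs K γ k (φ₁ + φ₂) (u₁ + u₂) := by
  obtain ⟨B₁, b₁, d₁, ⟨C₁, τ₁, hC₁, hτ₁, e₁⟩, i₁⟩ := h₁
  obtain ⟨B₂, b₂, d₂, ⟨C₂, τ₂, hC₂, hτ₂, e₂⟩, i₂⟩ := h₂
  refine ⟨B₁ + B₂, b₁.add b₂ d₁ d₂, d₁.add d₂,
    ⟨C₁ + C₂, τ₁ + τ₂, by positivity, by positivity, fun z => ?_⟩, fun z => ?_⟩
  · refine (norm_add_le _ _).trans ?_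
    rw [add_mul]
    refine add_le_add ((e₁ z).trans ?_) ((e₂ z).trans ?_)
    · gcongr
      linarith
    · gcongr
      linarith
  · have h3 : ∀ t, Complex.exp (γ t * z) * k (γ t) * (B₁ + B₂) (γ t) * deriv γ t =
        Complex.exp (γ t * z) * k (γ t) * B₁ (γ t) * deriv γ t +
        Complex.exp (γ t * z) * k (γ t) * B₂ (γ t) * deriv γ t := fun t => by
      simp only [Pi.add_apply]; ring
    have e1 := (i₁ z).2
    have e2 := (i₂ z).2
    simp only [curveIntegral] at e1 e2 ⊢
    simp only [h3]
    refine ⟨(i₁ z).1.add (i₂ z).1, ?_⟩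
    rw [intervalIntegral.integral_add (i₁ z).1 (i₂ z).1, e1, e2, ← mul_add]
    rfl

/-- Cauchy's formula for `e^{sz} k(s)`, integrated against the coefficients: exponentials are
eigenfunctions of the operator, and this passes to superpositions. -/
lemma IsExpData.actsAs {K Ω : Set ℂ} {μ : Measure ℝ} [SFinite μ] {s c : ℝ → ℂ}
    (H : IsExpData K μ s c) {γ : ℝ → ℂ} (hγ : ContDiff ℝ 1 γ) (hγΩ : IsEnclosingCurve Ω K γ)
    {k : ℂ → ℂ} (hk : DifferentiableOn ℂ k Ω)
    (hC : ∀ f : ℂ → ℂ, DifferentiableOn ℂ f Ω → ∀ w ∈ K,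
      curveIntegral γ (fun s => f s / (s - w)) = 2 * Real.pi * Complex.I * f w) :
    ActsAs K γ k (expIntegral μ s c) (expIntegral μ s (fun x => k (s x) * c x)) := by
  refine ⟨_, H.isBorelContinuation, H.differentiable, H.exists_norm_le, fun z => ?_⟩
  have hd : DifferentiableOn ℂ (fun s => Complex.exp (s * z) * k s) Ω :=
    DifferentiableOn.mul (by fun_prop) hk
  have := H.curveIntegral_mul_cauchyTransform hγ (fun t ht => (hγΩ.subset t ht).2)
    (k := fun s => Complex.exp (s * z) * k s)
    (hd.continuousOn.comp hγ.continuous.continuousOn fun t ht => (hγΩ.subset t ht).1) (hC _ hd)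
  refine ⟨this.1, this.2.trans ?_⟩
  simp only [expIntegral, mul_assoc]

lemma arcIntegral_expKernel {δ ψ : ℝ} (hψ : 0 < ψ) (C : ℂ → ℂ) :
    (fun z => arcIntegral δ ψ (expKernel C z)) =
      expIntegral (volume.restrict (Ioc (-ψ) ψ)) (fun θ => Complex.exp (polarLog δ θ))
        (fun θ => (2 * Real.pi * Complex.I)⁻¹ * (Complex.I * δ * Complex.exp (θ * Complex.I)) *
          C (polarLog δ θ)) := by
  ext z
  rw [arcIntegral, intervalIntegral.integral_of_le (by linarith), ← integral_const_mul, expIntegral]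
  congr 1
  ext θ
  rw [expKernel]
  ring

/-- The factor `a` carries the orientation: `1` for the outgoing ray, `-1` for the incoming one. -/
lemma rayIntegral_expKernel {δ r : ℝ} (hr : δ ≤ r) (θ : ℝ) (C : ℂ → ℂ) (a : ℂ) :
    (fun z => a * rayIntegral δ r θ (expKernel C z)) =
      expIntegral (volume.restrict (Ioc δ r)) (fun t => Complex.exp (polarLog t θ))
        (fun t => a * (2 * Real.pi * Complex.I)⁻¹ * Complex.exp (θ * Complex.I) *
          C (polarLog t θ)) := by
  ext z
  rw [rayIntegral, intervalIntegral.integral_of_le hr, ← mul_assoc, ← integral_const_mul,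
    expIntegral]
  congr 1
  ext t
  rw [expKernel]
  ring

lemma IsCoeff.isExpData_arc {δ ψ M r : ℝ} {C : ℂ → ℂ} (hC : IsCoeff δ ψ M C) (hδ : 0 < δ)
    (hr : δ < r) :
    IsExpData (contourSet δ ψ r) (volume.restrict (Ioc (-ψ) ψ))
      (fun θ => Complex.exp (polarLog δ θ))
      (fun θ => (2 * Real.pi * Complex.I)⁻¹ * (Complex.I * δ * Complex.exp (θ * Complex.I)) *
          C (polarLog δ θ)) := by
  have hp : Continuous fun θ : ℝ => polarLog δ θ := by unfold polarLog; fun_prop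
  refine ⟨isCompact_contourSet δ ψ r, hp.cexp.aestronglyMeasurable, ?_, ?_⟩
  · filter_upwards [ae_restrict_mem measurableSet_Ioc] with θ hθ
    refine ⟨_, ⟨(polarLog_re _ _).ge, ?_, ?_, Or.inl (polarLog_re _ _)⟩, rfl⟩
    · rw [polarLog_re]; exact Real.log_le_log hδ hr.le
    · rw [polarLog_im]; exact abs_le.2 ⟨hθ.1.le, hθ.2⟩
  · have h2 : ContinuousOn (fun θ : ℝ => C (polarLog δ θ)) (Icc (-ψ) ψ) :=
      hC.continuousOn.comp hp.continuousOn fun θ hθ => arc_mem_coeffRegion (abs_le.2 hθ)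
    exact (ContinuousOn.mul (by fun_prop) h2).integrableOn_Icc.mono_set Ioc_subset_Icc_self

lemma IsCoeff.isExpData_ray {δ ψ M r θ : ℝ} {C : ℂ → ℂ} (hC : IsCoeff δ ψ M C) (hδ : 0 < δ)
    (hψ : 3 * Real.pi / 4 < ψ) (hθ : |θ| = ψ) (a : ℂ) :
    IsExpData (contourSet δ ψ r)
      (volume.restrict (Ioc δ r)) (fun t => Complex.exp (polarLog t θ))
      (fun t => a * (2 * Real.pi * Complex.I)⁻¹ * Complex.exp (θ * Complex.I) *
          C (polarLog t θ)) := by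
  have hsub : Ioc δ r ⊆ Ici δ := fun t ht => ht.1.le
  have hsub' : Icc δ r ⊆ Ici δ := fun t ht => ht.1
  refine ⟨isCompact_contourSet δ ψ r,
    ((continuousOn_polarLog hδ θ).mono hsub).cexp.aestronglyMeasurable measurableSet_Ioc, ?_, ?_⟩
  · filter_upwards [ae_restrict_mem measurableSet_Ioc] with t ht
    refine ⟨_, ⟨?_, ?_, ?_, Or.inr ?_⟩, rfl⟩
    · rw [polarLog_re]; exact Real.log_le_log hδ ht.1.le
    · rw [polarLog_re]; exact Real.log_le_log (hδ.trans ht.1) ht.2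
    · rw [polarLog_im]; exact hθ.le
    · rw [polarLog_im]; exact hθ
  · have h2 := (hC.continuousOn_ray hδ hθ.le (by rw [hθ]; exact hψ.le)).mono hsub'
    exact (ContinuousOn.mul (by fun_prop) h2).integrableOn_Icc.mono_set Ioc_subset_Icc_self

lemma truncatedIntegral_expKernel {δ ψ r : ℝ} (hψ : 0 < ψ) (hr : δ < r) (C : ℂ → ℂ) :
    (fun z => truncatedIntegral δ ψ r (expKernel C z)) =
      expIntegral (volume.restrict (Ioc (-ψ) ψ)) (fun θ => Complex.exp (polarLog δ θ))
        (fun θ => (2 * Real.pi * Complex.I)⁻¹ * (Complex.I * δ * Complex.exp (θ * Complex.I)) *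
          C (polarLog δ θ)) +
      expIntegral (volume.restrict (Ioc δ r)) (fun t => Complex.exp (polarLog t ψ))
        (fun t => 1 * (2 * Real.pi * Complex.I)⁻¹ * Complex.exp (ψ * Complex.I) *
          C (polarLog t ψ)) +
      expIntegral (volume.restrict (Ioc δ r)) (fun t => Complex.exp (polarLog t (-ψ)))
        (fun t => (-1) * (2 * Real.pi * Complex.I)⁻¹ * Complex.exp ((-ψ : ℝ) * Complex.I) *
          C (polarLog t (-ψ))) := by
  rw [← arcIntegral_expKernel hψ, ← rayIntegral_expKernel hr.le, ← rayIntegral_expKernel hr.le]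
  ext z
  simp only [truncatedIntegral_eq, Pi.add_apply]
  ring

lemma IsCoeff.actsAs {δ ψ M r : ℝ} {C k : ℂ → ℂ} {Ω : Set ℂ} {γ : ℝ → ℂ} (hC : IsCoeff δ ψ M C)
    (hδ : 0 < δ) (hψ : 3 * Real.pi / 4 < ψ) (hr : δ < r)
    (hγ : ContDiff ℝ 1 γ) (hγΩ : IsEnclosingCurve Ω (contourSet δ ψ r) γ)
    (hk : DifferentiableOn ℂ k Ω)
    (hCauchy : ∀ f : ℂ → ℂ, DifferentiableOn ℂ f Ω → ∀ w ∈ contourSet δ ψ r,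
      curveIntegral γ (fun s => f s / (s - w)) = 2 * Real.pi * Complex.I * f w) :
    ActsAs (contourSet δ ψ r) γ k (fun z => truncatedIntegral δ ψ r (expKernel C z))
      (fun z => truncatedIntegral δ ψ r (expKernel (fun w => k (Complex.exp w) * C w) z)) := by
  have hψ0 : 0 < ψ := lt_trans (by positivity) hψ
  have h1 := (hC.isExpData_arc hδ hr).actsAs hγ hγΩ hk hCauchy
  have h2 := (hC.isExpData_ray hδ hψ (abs_of_pos hψ0) 1).actsAs hγ hγΩ hk hCauchy
  have h3 := (hC.isExpData_ray hδ hψ (by rw [abs_neg, abs_of_pos hψ0] : |-ψ| = ψ) (-1)).actsAs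
    hγ hγΩ hk hCauchy
  rw [truncatedIntegral_expKernel hψ0 hr, truncatedIntegral_expKernel hψ0 hr]
  simp only [mul_left_comm (k _)] at h1 h2 h3
  exact (h1.add h2).add h3

lemma IsCoeff.hasDerivAt_truncatedIntegral {δ ψ M r : ℝ} {C : ℂ → ℂ} (hC : IsCoeff δ ψ M C)
    (hδ : 0 < δ) (hψ : 3 * Real.pi / 4 < ψ) (hr : δ < r) (z : ℂ) :
    HasDerivAt (fun z => truncatedIntegral δ ψ r (expKernel C z))
      (truncatedIntegral δ ψ r (expKernel (fun w => Complex.exp w * C w) z)) z := by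
  have hψ0 : 0 < ψ := lt_trans (by positivity) hψ
  have h1 := (hC.isExpData_arc hδ hr).hasDerivAt z
  have h2 := (hC.isExpData_ray (r := r) hδ hψ (abs_of_pos hψ0) 1).hasDerivAt z
  have h3 := (hC.isExpData_ray (r := r) hδ hψ (by rw [abs_neg, abs_of_pos hψ0] : |-ψ| = ψ)
    (-1)).hasDerivAt z
  have key := congrFun (truncatedIntegral_expKernel hψ0 hr (fun w => Complex.exp w * C w)) z
  beta_reduce at key
  rw [truncatedIntegral_expKernel hψ0 hr, key]
  simp only [mul_left_comm (Complex.exp (polarLog _ _))] at h1 h2 h3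
  exact (h1.add h2).add h3

/-- The integral over the whole contour is analytic in the angular region. -/
lemma IsCoeff.differentiableOn_angularIntegral {δ ψ M : ℝ} {C : ℂ → ℂ} (hC : IsCoeff δ ψ M C)
    (hδ : 0 < δ) (hψ : 3 * Real.pi / 4 < ψ) (hψ' : ψ ≤ Real.pi) :
    DifferentiableOn ℂ (fun z => angularIntegral δ ψ (expKernel C z)) (angularRegion ψ) := by
  have hopen := isOpen_angularRegion hψ hψ'
  refine ((tendstoLocallyUniformlyOn_iff_forall_isCompact hopen).2
    (hC.compactConv hδ hψ hψ')).differentiableOn ?_ hopen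
  filter_upwards [eventually_gt_atTop δ] with r hr z _
  exact (hC.hasDerivAt_truncatedIntegral hδ hψ hr z).differentiableAt.differentiableWithinAt

/-- Differentiation under the integral over the whole contour. -/
lemma IsCoeff.hasDerivAt_angularIntegral {δ ψ M M' : ℝ} {C : ℂ → ℂ} (hC : IsCoeff δ ψ M C)
    (hC' : IsCoeff δ ψ M' (fun w => Complex.exp w * C w))
    (hδ : 0 < δ) (hψ : 3 * Real.pi / 4 < ψ) (hψ' : ψ ≤ Real.pi) {z : ℂ}
    (hz : z ∈ angularRegion ψ) :
    HasDerivAt (fun z => angularIntegral δ ψ (expKernel C z))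
      (angularIntegral δ ψ (expKernel (fun w => Complex.exp w * C w) z)) z := by
  have hopen := isOpen_angularRegion hψ hψ'
  -- The derivatives of the truncations have the coefficient `s C(s)`, bounded by `hC'`, so they too
  -- converge locally uniformly.
  refine hasDerivAt_of_tendstoLocallyUniformlyOn hopen
    ((tendstoLocallyUniformlyOn_iff_forall_isCompact hopen).2 (hC'.compactConv hδ hψ hψ')) ?_
    (fun x hx => (hC.compactConv hδ hψ hψ').tendsto hx) hz
  filter_upwards [eventually_gt_atTop δ] with r hr z _
  exact hC.hasDerivAt_truncatedIntegral hδ hψ hr z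

/-- Agreement on the trace alone is what is needed: `ζ · (F / ζ) = F` is known only where the symbol
does not vanish. -/
lemma truncatedIntegral_congr {δ ψ r : ℝ} (hδ : 0 < δ) (hψ : 0 < ψ) (hr : δ < r)
    {H₁ H₂ : ℂ → ℂ} (h : EqOn H₁ H₂ (contourLog δ ψ r)) :
    truncatedIntegral δ ψ r H₁ = truncatedIntegral δ ψ r H₂ := by
  have hray : ∀ θ : ℝ, |θ| = ψ → rayIntegral δ r θ H₁ = rayIntegral δ r θ H₂ := by
    intro θ hθ
    rw [rayIntegral, rayIntegral]
    congr 1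
    refine intervalIntegral.integral_congr fun t ht => ?_
    rw [uIcc_of_le hr.le] at ht
    rw [h ⟨?_, ?_, ?_, Or.inr ?_⟩]
    · rw [polarLog_re]; exact Real.log_le_log hδ ht.1
    · rw [polarLog_re]; exact Real.log_le_log (hδ.trans_le ht.1) ht.2
    · rw [polarLog_im]; exact hθ.le
    · rw [polarLog_im]; exact hθ
  rw [truncatedIntegral_eq, truncatedIntegral_eq, hray ψ (abs_of_pos hψ),
    hray (-ψ) (by rw [abs_neg, abs_of_pos hψ]), arcIntegral, arcIntegral]
  congr 3
  refine intervalIntegral.integral_congr fun θ hθ => ?_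
  rw [uIcc_of_le (by linarith)] at hθ
  rw [h ⟨(polarLog_re _ _).ge, ?_, ?_, Or.inl (polarLog_re _ _)⟩]
  · rw [polarLog_re]; exact Real.log_le_log hδ hr.le
  · rw [polarLog_im]; exact abs_le.2 hθ

/-! ### Integrals over the boundary of a rectangle -/

/-- The integral over the positively oriented boundary of the rectangle `[a, b] × [c, d]`. -/
def rectIntegral (a b c d : ℝ) (f : ℂ → ℂ) : ℂ :=
  (∫ x : ℝ in a..b, f (x + c * Complex.I)) - (∫ x : ℝ in a..b, f (x + d * Complex.I)) +
    Complex.I * (∫ y : ℝ in c..d, f (b + y * Complex.I)) -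
    Complex.I * ∫ y : ℝ in c..d, f (a + y * Complex.I)

lemma rectIntegral_eq_zero {a b c d : ℝ} (hab : a ≤ b) (hcd : c ≤ d) {f : ℂ → ℂ}
    (hf : ContinuousOn f (Icc a b ×ℂ Icc c d)) (hd : DifferentiableOn ℂ f (Ioo a b ×ℂ Ioo c d)) :
    rectIntegral a b c d f = 0 := by
  have := Complex.integral_boundary_rect_eq_zero_of_continuousOn_of_differentiableOn f
    (a + c * Complex.I) (b + d * Complex.I)
    (by simpa [uIcc_of_le hab, uIcc_of_le hcd] using hf)
    (by simpa [min_eq_left hab, max_eq_right hab, min_eq_left hcd, max_eq_right hcd] using hd)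
  simpa [rectIntegral] using this

/-- Functions agreeing on the boundary of a rectangle have the same boundary integral. -/
lemma rectIntegral_congr {a b c d : ℝ} (hab : a ≤ b) (hcd : c ≤ d) {f g : ℂ → ℂ}
    (h : ∀ w ∈ Icc a b ×ℂ Icc c d \ Ioo a b ×ℂ Ioo c d, f w = g w) :
    rectIntegral a b c d f = rectIntegral a b c d g := by
  have h1 : ∀ x ∈ uIcc a b, f (x + c * Complex.I) = g (x + c * Complex.I) := fun x hx => by
    rw [uIcc_of_le hab] at hx
    exact h _ ⟨by simp [Complex.mem_reProdIm, hx.1, hx.2, hcd], by simp [Complex.mem_reProdIm]⟩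
  have h2 : ∀ x ∈ uIcc a b, f (x + d * Complex.I) = g (x + d * Complex.I) := fun x hx => by
    rw [uIcc_of_le hab] at hx
    exact h _ ⟨by simp [Complex.mem_reProdIm, hx.1, hx.2, hcd], by simp [Complex.mem_reProdIm]⟩
  have h3 : ∀ y ∈ uIcc c d, f (b + y * Complex.I) = g (b + y * Complex.I) := fun x hx => by
    rw [uIcc_of_le hcd] at hx
    exact h _ ⟨by simp [Complex.mem_reProdIm, hx.1, hx.2, hab], by simp [Complex.mem_reProdIm]⟩
  have h4 : ∀ y ∈ uIcc c d, f (a + y * Complex.I) = g (a + y * Complex.I) := fun x hx => by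
    rw [uIcc_of_le hcd] at hx
    exact h _ ⟨by simp [Complex.mem_reProdIm, hx.1, hx.2, hab], by simp [Complex.mem_reProdIm]⟩
  rw [rectIntegral, rectIntegral, intervalIntegral.integral_congr h1,
    intervalIntegral.integral_congr h2, intervalIntegral.integral_congr h3,
    intervalIntegral.integral_congr h4]

lemma rectIntegral_add {a b c d : ℝ} (hab : a ≤ b) (hcd : c ≤ d) {f g : ℂ → ℂ}
    (hf : ContinuousOn f (Icc a b ×ℂ Icc c d \ Ioo a b ×ℂ Ioo c d))
    (hg : ContinuousOn g (Icc a b ×ℂ Icc c d \ Ioo a b ×ℂ Ioo c d)) :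
    rectIntegral a b c d (fun w => f w + g w) =
      rectIntegral a b c d f + rectIntegral a b c d g := by
  have hx : ∀ k : ℂ → ℂ, ContinuousOn k (Icc a b ×ℂ Icc c d \ Ioo a b ×ℂ Ioo c d) →
      ∀ e : ℝ, e = c ∨ e = d → IntervalIntegrable (fun x : ℝ => k (x + e * Complex.I)) volume a b := by
    intro k hk e he
    refine ContinuousOn.intervalIntegrable (hk.comp (by fun_prop) fun x hx => ?_)
    rw [uIcc_of_le hab] at hx
    rcases he with rfl | rfl <;> simp [Complex.mem_reProdIm, hx.1, hx.2, hcd]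
  have hy : ∀ k : ℂ → ℂ, ContinuousOn k (Icc a b ×ℂ Icc c d \ Ioo a b ×ℂ Ioo c d) →
      ∀ e : ℝ, e = a ∨ e = b → IntervalIntegrable (fun y : ℝ => k (e + y * Complex.I)) volume c d := by
    intro k hk e he
    refine ContinuousOn.intervalIntegrable (hk.comp (by fun_prop) fun y hy => ?_)
    rw [uIcc_of_le hcd] at hy
    rcases he with rfl | rfl <;> simp [Complex.mem_reProdIm, hy.1, hy.2, hab]
  simp only [rectIntegral]
  rw [intervalIntegral.integral_add (hx f hf c (Or.inl rfl)) (hx g hg c (Or.inl rfl)),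
    intervalIntegral.integral_add (hx f hf d (Or.inr rfl)) (hx g hg d (Or.inr rfl)),
    intervalIntegral.integral_add (hy f hf a (Or.inl rfl)) (hy g hg a (Or.inl rfl)),
    intervalIntegral.integral_add (hy f hf b (Or.inr rfl)) (hy g hg b (Or.inr rfl))]
  ring

lemma rectIntegral_const_mul (a b c d : ℝ) (k : ℂ) (f : ℂ → ℂ) :
    rectIntegral a b c d (fun w => k * f w) = k * rectIntegral a b c d f := by
  simp only [rectIntegral, intervalIntegral.integral_const_mul]
  ring

lemma log_neg_of_im_pos {w : ℂ} (hw : 0 < w.im) :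
    Complex.log (-w) = Complex.log w - Real.pi * Complex.I := by
  rw [Complex.log, Complex.log, norm_neg, Complex.arg_neg_eq_arg_sub_pi_of_im_pos hw]
  push_cast
  ring

lemma log_neg_of_im_neg {w : ℂ} (hw : w.im < 0) :
    Complex.log (-w) = Complex.log w + Real.pi * Complex.I := by
  rw [Complex.log, Complex.log, norm_neg, Complex.arg_neg_eq_arg_add_pi_of_im_neg hw]
  push_cast
  ring

/-- On three sides `log (w - w₀)` is a primitive. The left side crosses the cut, so `log (-(w -
w₀))` is used there; the two branches differ by `πi` in opposite senses at the two left corners, and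
together this gives `2πi`. -/
lemma rectIntegral_sub_inv {a b c d : ℝ} {w₀ : ℂ} (h : w₀ ∈ Ioo a b ×ℂ Ioo c d) :
    rectIntegral a b c d (fun w => (w - w₀)⁻¹) = 2 * Real.pi * Complex.I := by
  obtain ⟨⟨ha, hb⟩, hc, hd⟩ := h
  have hx : ∀ e : ℝ, e ≠ w₀.im → ∫ x : ℝ in a..b, ((x : ℂ) + e * Complex.I - w₀)⁻¹ =
      Complex.log (b + e * Complex.I - w₀) - Complex.log (a + e * Complex.I - w₀) := by
    intro e he
    have hne : ∀ x : ℝ, (x : ℂ) + e * Complex.I - w₀ ∈ Complex.slitPlane := fun x =>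
      Or.inr (by simpa [sub_eq_zero] using he)
    refine intervalIntegral.integral_eq_sub_of_hasDerivAt
      (f := fun x : ℝ => Complex.log ((x : ℂ) + e * Complex.I - w₀)) (fun x _ => ?_) ?_
    · have h1 : HasDerivAt (fun x : ℝ => (x : ℂ) + e * Complex.I - w₀) 1 x :=
        ((Complex.ofRealCLM.hasDerivAt (x := x)).add_const _).sub_const _
      simpa using h1.clog_real (hne x)
    · refine ContinuousOn.intervalIntegrable (ContinuousOn.inv₀ (by fun_prop) fun x _ => ?_)
      exact Complex.slitPlane_ne_zero (hne x)
  have hr : Complex.I * ∫ y : ℝ in c..d, ((b : ℂ) + y * Complex.I - w₀)⁻¹ =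
      Complex.log (b + d * Complex.I - w₀) - Complex.log (b + c * Complex.I - w₀) := by
    have hne : ∀ y : ℝ, (b : ℂ) + y * Complex.I - w₀ ∈ Complex.slitPlane := fun y =>
      Or.inl (by simpa using hb)
    rw [← intervalIntegral.integral_const_mul]
    refine intervalIntegral.integral_eq_sub_of_hasDerivAt
      (f := fun y : ℝ => Complex.log ((b : ℂ) + y * Complex.I - w₀)) (fun y _ => ?_) ?_
    · have h1 : HasDerivAt (fun y : ℝ => (b : ℂ) + y * Complex.I - w₀) Complex.I y := by
        simpa using (((Complex.ofRealCLM.hasDerivAt (x := y)).mul_const Complex.I).const_add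
          (b : ℂ)).sub_const w₀
      simpa [div_eq_mul_inv] using h1.clog_real (hne y)
    · refine ContinuousOn.intervalIntegrable (continuousOn_const.mul
        (ContinuousOn.inv₀ (by fun_prop) fun y _ => ?_))
      exact Complex.slitPlane_ne_zero (hne y)
  have hl : Complex.I * ∫ y : ℝ in c..d, ((a : ℂ) + y * Complex.I - w₀)⁻¹ =
      Complex.log (-(a + d * Complex.I - w₀)) - Complex.log (-(a + c * Complex.I - w₀)) := by
    have hne : ∀ y : ℝ, -((a : ℂ) + y * Complex.I - w₀) ∈ Complex.slitPlane := fun y =>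
      Or.inl (by simpa using ha)
    rw [← intervalIntegral.integral_const_mul]
    refine intervalIntegral.integral_eq_sub_of_hasDerivAt
      (f := fun y : ℝ => Complex.log (-((a : ℂ) + y * Complex.I - w₀))) (fun y _ => ?_) ?_
    · have h1 : HasDerivAt (fun y : ℝ => -((a : ℂ) + y * Complex.I - w₀)) (-Complex.I) y := by
        have h2 := ((((Complex.ofRealCLM.hasDerivAt (x := y)).mul_const Complex.I).const_add
          (a : ℂ)).sub_const w₀).neg
        exact h2.congr_deriv (by simp)
      have := h1.clog_real (hne y)
      rwa [neg_div_neg_eq, div_eq_mul_inv] at this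
    · refine ContinuousOn.intervalIntegrable (continuousOn_const.mul
        (ContinuousOn.inv₀ (by fun_prop) fun y _ => ?_))
      exact neg_ne_zero.1 (Complex.slitPlane_ne_zero (hne y))
  rw [rectIntegral, hx c hc.ne, hx d hd.ne', hr, hl, log_neg_of_im_pos (by simpa using hd),
    log_neg_of_im_neg (by simpa using hc)]
  ring

/-- Cauchy's integral formula for a rectangle. -/
lemma rectIntegral_div_sub {a b c d : ℝ} {f : ℂ → ℂ}
    (hf : ContinuousOn f (Icc a b ×ℂ Icc c d)) (hd : DifferentiableOn ℂ f (Ioo a b ×ℂ Ioo c d))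
    {w₀ : ℂ} (h : w₀ ∈ Ioo a b ×ℂ Ioo c d) :
    rectIntegral a b c d (fun w => f w / (w - w₀)) = 2 * Real.pi * Complex.I * f w₀ := by
  have hab : a ≤ b := (h.1.1.trans h.1.2).le
  have hcd : c ≤ d := (h.2.1.trans h.2.2).le
  have hopen : IsOpen (Ioo a b ×ℂ Ioo c d) := isOpen_Ioo.reProdIm isOpen_Ioo
  have hn := hopen.mem_nhds h
  have hsub : Ioo a b ×ℂ Ioo c d ⊆ Icc a b ×ℂ Icc c d := fun w hw =>
    ⟨Ioo_subset_Icc_self hw.1, Ioo_subset_Icc_self hw.2⟩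
  have hne : ∀ w ∈ Icc a b ×ℂ Icc c d \ Ioo a b ×ℂ Ioo c d, w ≠ w₀ := by
    rintro w hw rfl
    exact hw.2 h
  have h1 : ContinuousOn (dslope f w₀) (Icc a b ×ℂ Icc c d) :=
    (continuousOn_dslope (mem_of_superset hn hsub)).2 ⟨hf, hd.differentiableAt hn⟩
  have h2 : rectIntegral a b c d (dslope f w₀) = 0 :=
    rectIntegral_eq_zero hab hcd h1 ((Complex.differentiableOn_dslope hn).2 hd)
  rw [rectIntegral_congr hab hcd (g := fun w => dslope f w₀ w + f w₀ * (w - w₀)⁻¹)]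
  · rw [rectIntegral_add hab hcd (h1.mono sdiff_subset), h2, rectIntegral_const_mul,
      rectIntegral_sub_inv h]
    · ring
    · exact continuousOn_const.mul (ContinuousOn.inv₀ (by fun_prop) fun w hw =>
        sub_ne_zero.2 (hne w hw))
  · intro w hw
    have hw' : w - w₀ ≠ 0 := sub_ne_zero.2 (hne w hw)
    rw [dslope_of_ne _ (hne w hw), slope_def_field]
    field_simp
    ring

/-! ### Deformation of angular contours -/

/-- `∫ H ds / 2πi` over the arc `|s| = ρ`, `a ≤ arg s ≤ b`. -/
def arcSegment (ρ a b : ℝ) (H : ℂ → ℂ) : ℂ :=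
  (2 * Real.pi * Complex.I)⁻¹ *
    ∫ θ in a..b, H (polarLog ρ θ) * (Complex.I * ρ * Complex.exp (θ * Complex.I))

lemma rayIntegral_eq_log {δ ρ θ : ℝ} (hδ : 0 < δ) (hρ : δ ≤ ρ) {H : ℂ → ℂ}
    (hH : ContinuousOn (fun t => H (polarLog t θ)) (Ici δ)) :
    rayIntegral δ ρ θ H = (2 * Real.pi * Complex.I)⁻¹ *
      ∫ x in Real.log δ..Real.log ρ,
        H (x + θ * Complex.I) * Complex.exp (x + θ * Complex.I) := by
  have hlog : Real.log δ ≤ Real.log ρ := Real.log_le_log hδ hρ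
  have := intervalIntegral.integral_deriv_smul_comp' (a := Real.log δ) (b := Real.log ρ)
    (f := Real.exp) (f' := Real.exp)
    (g := fun t => H (polarLog t θ) * Complex.exp (θ * Complex.I))
    (fun x _ => Real.hasDerivAt_exp x) Real.continuous_exp.continuousOn ?_
  · rw [Real.exp_log hδ, Real.exp_log (hδ.trans_le hρ)] at this
    rw [rayIntegral, ← this]
    congr 2
    ext x
    simp only [Function.comp, polarLog, Real.log_exp, Complex.real_smul, Complex.exp_add,
      Complex.ofReal_exp]
    ring
  · refine (hH.mul continuousOn_const).mono ?_
    rintro _ ⟨x, hx, rfl⟩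
    rw [uIcc_of_le hlog] at hx
    exact (Real.log_le_iff_le_exp hδ).1 hx.1

/-- Under `s = e^w`, `ds = e^w dw`, the annular sector becomes a rectangle: rays turn into
horizontal sides and arcs into vertical ones. -/
lemma rect_eq_contours {δ ρ a b : ℝ} (hδ : 0 < δ) (hρ : δ ≤ ρ) {H : ℂ → ℂ}
    (ha : ContinuousOn (fun t => H (polarLog t a)) (Ici δ))
    (hb : ContinuousOn (fun t => H (polarLog t b)) (Ici δ)) :
    rayIntegral δ ρ a H - rayIntegral δ ρ b H + arcSegment ρ a b H - arcSegment δ a b H =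
      (2 * Real.pi * Complex.I)⁻¹ * rectIntegral (Real.log δ) (Real.log ρ) a b
        (fun w => H w * Complex.exp w) := by
  have harc : ∀ ρ : ℝ, 0 < ρ → arcSegment ρ a b H = (2 * Real.pi * Complex.I)⁻¹ * (Complex.I *
      ∫ y : ℝ in a..b, H (Real.log ρ + y * Complex.I) *
        Complex.exp (Real.log ρ + y * Complex.I)) := by
    intro ρ hρ
    rw [arcSegment, ← intervalIntegral.integral_const_mul Complex.I]
    congr 1
    refine intervalIntegral.integral_congr fun y _ => ?_
    rw [Complex.exp_add, ← Complex.ofReal_exp, Real.exp_log hρ, polarLog]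
    ring
  rw [rayIntegral_eq_log hδ hρ ha, rayIntegral_eq_log hδ hρ hb, harc ρ (hδ.trans_le hρ), harc δ hδ,
    rectIntegral]
  ring

lemma norm_arcSegment_le {ρ a b B : ℝ} (hρ : 0 < ρ) (hab : a ≤ b) {H : ℂ → ℂ}
    (hH : ∀ θ ∈ Icc a b, ‖H (polarLog ρ θ)‖ ≤ B) : ‖arcSegment ρ a b H‖ ≤ B * ρ * (b - a) := by
  rw [arcSegment, norm_mul]
  refine (mul_le_of_le_one_left (norm_nonneg _) norm_two_pi_I_inv_le).trans ?_
  rw [← abs_of_nonneg (sub_nonneg.2 hab)]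
  refine intervalIntegral.norm_integral_le_of_norm_le_const fun θ hθ => ?_
  rw [uIoc_of_le hab] at hθ
  simp only [norm_mul, Complex.norm_exp_ofReal_mul_I, Complex.norm_I, Complex.norm_real,
    Real.norm_eq_abs, abs_of_pos hρ, mul_one, one_mul]
  gcongr
  exact hH θ ⟨hθ.1.le, hθ.2⟩

lemma angularRegion_subset {ψ' ψ : ℝ} (h : ψ' ≤ ψ) : angularRegion ψ' ⊆ angularRegion ψ :=
  fun _ hz => ⟨hz.1, hz.2.trans_le (by linarith)⟩

/-- The integral over the angular contour does not depend on its half-opening. -/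
lemma IsCoeff.angularIntegral_eq_of_le {δ ψ ψ' M : ℝ} {C : ℂ → ℂ} (hC : IsCoeff δ ψ M C)
    (hd : DifferentiableOn ℂ C {w | Real.log δ < w.re ∧ 3 * Real.pi / 4 < |w.im| ∧ |w.im| < ψ})
    (hδ : 0 < δ) (hψ : 3 * Real.pi / 4 < ψ') (hψψ : ψ' ≤ ψ) (hψ' : ψ ≤ Real.pi) {z : ℂ}
    (hz : z ∈ angularRegion ψ') :
    angularIntegral δ ψ' (expKernel C z) = angularIntegral δ ψ (expKernel C z) := by
  have h34 : 0 < 3 * Real.pi / 4 := by positivity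
  have hpos : 0 < ψ' := h34.trans hψ
  have hpos' : 0 < ψ := hpos.trans_le hψψ
  -- the two sectors between the contours
  have hsector : ∀ a b : ℝ, a ≤ b → (∀ y ∈ Icc a b, ψ' ≤ |y| ∧ |y| ≤ ψ) →
      (∀ y ∈ Ioo a b, ψ' < |y| ∧ |y| < ψ) →
      (∀ ρ, δ ≤ ρ → rayIntegral δ ρ a (expKernel C z) - rayIntegral δ ρ b (expKernel C z) +
        arcSegment ρ a b (expKernel C z) - arcSegment δ a b (expKernel C z) = 0) ∧
      Tendsto (fun ρ => arcSegment ρ a b (expKernel C z)) atTop (𝓝 0) := by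
    intro a b hab h1 h2
    have hr : ∀ y ∈ Icc a b, |y| ≤ ψ ∧ 3 * Real.pi / 4 ≤ |y| := fun y hy =>
      ⟨(h1 y hy).2, hψ.le.trans (h1 y hy).1⟩
    constructor
    · intro ρ hρ
      rw [rect_eq_contours hδ hρ
        (hC.continuousOn_ray_expKernel hδ (hr a ⟨le_rfl, hab⟩).1 (hr a ⟨le_rfl, hab⟩).2 z)
        (hC.continuousOn_ray_expKernel hδ (hr b ⟨hab, le_rfl⟩).1 (hr b ⟨hab, le_rfl⟩).2 z)]
      rw [rectIntegral_eq_zero (Real.log_le_log hδ hρ) hab, mul_zero]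
      · have h3 : ContinuousOn C (Icc (Real.log δ) (Real.log ρ) ×ℂ Icc a b) :=
          hC.continuousOn.mono fun w hw => ⟨hw.1.1, (hr _ hw.2).1, Or.inr (hr _ hw.2).2⟩
        unfold expKernel
        fun_prop
      · have h3 : DifferentiableOn ℂ C (Ioo (Real.log δ) (Real.log ρ) ×ℂ Ioo a b) :=
          hd.mono fun w hw => ⟨hw.1.1, hψ.trans (h2 _ hw.2).1, (h2 _ hw.2).2⟩
        unfold expKernel
        fun_prop
    -- Every angle between the two openings gives a negative real part for `z` in the smaller
    -- region. Compactness gives one rate `c`, and `e^{-cρ}` beats the arc length `ρ (b - a)`.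
    · obtain ⟨c, hc, hcz⟩ := (isCompact_Icc (a := a) (b := b)).exists_forall_le'
        (f := fun θ : ℝ => -(Complex.exp (θ * Complex.I) * z).re) (by fun_prop) (a := 0)
        fun θ hθ => neg_pos.2 (angularRegion_re_neg (h1 θ hθ).1 ((h1 θ hθ).2.trans hψ') hz)
      have hlim : Tendsto (fun ρ : ℝ => M * Real.exp (-c * ρ) * ρ * (b - a)) atTop (𝓝 0) := by
        have := (Real.tendsto_pow_mul_exp_neg_atTop_nhds_zero 1).comp
          (tendsto_id.const_mul_atTop hc)
        have := (this.const_mul (M / c)).mul_const (b - a)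
        simp only [mul_zero, zero_mul] at this
        refine this.congr fun ρ => ?_
        simp only [Function.comp, id, pow_one]
        field_simp
      refine squeeze_zero_norm' ?_ hlim
      filter_upwards [eventually_ge_atTop δ] with ρ hρ
      refine norm_arcSegment_le (hδ.trans_le hρ) hab fun θ hθ => ?_
      exact hC.norm_expKernel_le hδ (hr θ hθ).1 (hr θ hθ).2 (by linarith [hcz θ hθ]) hρ
  obtain ⟨p1, p2⟩ := hsector ψ' ψ hψψ (fun y hy => by
      rw [abs_of_pos (hpos.trans_le hy.1)]; exact hy)
    (fun y hy => by rw [abs_of_pos (hpos.trans hy.1)]; exact hy)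
  obtain ⟨n1, n2⟩ := hsector (-ψ) (-ψ') (neg_le_neg hψψ)
    (fun y hy => by rw [abs_of_neg (by linarith [hy.2])]; exact ⟨by linarith [hy.2], by linarith [hy.1]⟩)
    (fun y hy => by rw [abs_of_neg (by linarith [hy.2])]; exact ⟨by linarith [hy.2], by linarith [hy.1]⟩)
  have t1 := ((hC.mono hψψ).compactConv hδ hψ (hψψ.trans hψ')).tendsto hz
  have t2 := (hC.compactConv hδ (hψ.trans_le hψψ) hψ').tendsto (angularRegion_subset hψψ hz)
  have hp : Continuous fun θ : ℝ => polarLog δ θ := by unfold polarLog; fun_prop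
  have hcont : ContinuousOn (fun θ : ℝ => expKernel C z (polarLog δ θ) *
      (Complex.I * δ * Complex.exp (θ * Complex.I))) (Icc (-ψ) ψ) := by
    have h2 : ContinuousOn (fun θ : ℝ => C (polarLog δ θ)) (Icc (-ψ) ψ) :=
      hC.continuousOn.comp hp.continuousOn fun θ hθ => arc_mem_coeffRegion (abs_le.2 hθ)
    exact (((hp.cexp.mul continuous_const).cexp.continuousOn).mul h2).mul (by fun_prop)
  have hint : ∀ a b : ℝ, -ψ ≤ a → a ≤ b → b ≤ ψ → IntervalIntegrable
      (fun θ : ℝ => expKernel C z (polarLog δ θ) *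
      (Complex.I * δ * Complex.exp (θ * Complex.I))) volume a b := fun a b h1 h2 h3 =>
    ContinuousOn.intervalIntegrable (by
      rw [uIcc_of_le h2]
      exact hcont.mono (Icc_subset_Icc h1 h3))
  have hsplit : arcIntegral δ ψ (expKernel C z) = arcSegment δ (-ψ) (-ψ') (expKernel C z) +
      arcIntegral δ ψ' (expKernel C z) + arcSegment δ ψ' ψ (expKernel C z) := by
    simp only [arcIntegral, arcSegment]
    rw [← mul_add, ← mul_add, intervalIntegral.integral_add_adjacent_intervals
      (hint _ _ le_rfl (by linarith) (by linarith)) (hint _ _ (by linarith) (by linarith) hψψ),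
      intervalIntegral.integral_add_adjacent_intervals
      (hint _ _ le_rfl (by linarith) hψψ) (hint _ _ (by linarith) hψψ le_rfl)]
  -- At each finite radius the two truncated integrals differ exactly by the two large arcs, which
  -- vanish in the limit.
  refine tendsto_nhds_unique t1 ((t2.sub (p2.add n2)).congr' ?_ |>.trans ?_)
  · filter_upwards [eventually_ge_atTop δ] with ρ hρ
    rw [truncatedIntegral_eq, truncatedIntegral_eq, hsplit]
    linear_combination -(p1 ρ hρ) - n1 ρ hρ
  · simp

/-! ### Laplace transforms -/

/-- The Laplace transform of a superposition of exponentials is a Cauchy transform. -/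
lemma laplace_expIntegral {μ : Measure ℝ} [SFinite μ] {s c : ℝ → ℂ} {S : ℂ}
    (hs : AEStronglyMeasurable s μ) (hc : AEStronglyMeasurable c μ)
    (hre : ∀ᵐ x ∂μ, (s x).re < S.re) (hi : Integrable (fun x => ‖c x‖ / (S.re - (s x).re)) μ) :
    IntegrableOn (fun t : ℝ => Complex.exp (-(t * S)) * expIntegral μ s c t) (Ioi 0) ∧
    ∫ t in Ioi (0 : ℝ), Complex.exp (-(t * S)) * expIntegral μ s c t = cauchyTransform μ s c S := by
  set ν : Measure ℝ := volume.restrict (Ioi 0)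
  have hmeas : AEStronglyMeasurable
      (fun p : ℝ × ℝ => Complex.exp ((s p.2 - S) * p.1) * c p.2) (ν.prod μ) := by
    have h1 : AEMeasurable (fun p : ℝ × ℝ => s p.2) (ν.prod μ) := hs.aemeasurable.comp_snd
    have h2 : AEMeasurable (fun p : ℝ × ℝ => c p.2) (ν.prod μ) := hc.aemeasurable.comp_snd
    have h3 : AEMeasurable (fun p : ℝ × ℝ => (p.1 : ℂ)) (ν.prod μ) :=
      (Complex.measurable_ofReal.comp measurable_fst).aemeasurable
    exact ((Complex.measurable_exp.comp_aemeasurable ((h1.sub_const S).mul h3)).mul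
      h2).aestronglyMeasurable
  have hprod : Integrable (fun p : ℝ × ℝ => Complex.exp ((s p.2 - S) * p.1) * c p.2)
      (ν.prod μ) := by
    -- By Tonelli, integrating the norm over `t` first leaves `‖c x‖ / (Re S - Re (s x))`, the
    -- function assumed integrable.
    rw [integrable_prod_iff' hmeas]
    constructor
    · filter_upwards [hre] with x hx
      exact (integrableOn_exp_mul_complex_Ioi (by simpa using hx) 0).mul_const _
    · refine hi.congr ?_
      filter_upwards [hre] with x hx
      have h1 : ∀ t : ℝ, ‖Complex.exp ((s x - S) * t) * c x‖ =
          Real.exp (((s x).re - S.re) * t) * ‖c x‖ := fun t => by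
        rw [norm_mul, Complex.norm_exp]
        simp
      simp only [h1]
      rw [integral_mul_const, integral_exp_mul_Ioi (by linarith), mul_zero, Real.exp_zero,
        neg_div, ← div_neg, neg_sub]
      ring
  have hinner : ∀ t : ℝ, ∫ x, Complex.exp ((s x - S) * t) * c x ∂μ =
      Complex.exp (-(t * S)) * expIntegral μ s c t := by
    intro t
    rw [expIntegral, ← integral_const_mul]
    congr 1
    ext x
    rw [← mul_assoc, ← Complex.exp_add]
    ring_nf
  constructor
  · exact hprod.integral_prod_left.congr (Eventually.of_forall hinner)
  · simp only [← hinner]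
    rw [integral_integral_swap hprod]
    refine integral_congr_ae ?_
    filter_upwards [hre] with x hx
    have hne : S - s x ≠ 0 := fun h0 => by
      rw [sub_eq_zero.1 h0] at hx
      exact lt_irrefl _ hx
    have hne' : s x - S ≠ 0 := fun h0 => hne (by rw [← neg_sub, h0, neg_zero])
    rw [integral_mul_const, integral_exp_mul_complex_Ioi (by simpa using hx)]
    simp only [Complex.ofReal_zero, mul_zero, Complex.exp_zero]
    rw [← neg_sub S, neg_div_neg_eq]
    ring

/-- A function whose Laplace transform vanishes on a vertical line vanishes at its points of
continuity. -/
lemma eq_zero_of_laplace_eq_zero {D : ℝ → ℂ} {σ : ℝ}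
    (hD : IntegrableOn (fun t : ℝ => Complex.exp (-(t * σ)) * D t) (Ioi 0))
    (h0 : ∀ y : ℝ, ∫ t in Ioi (0 : ℝ), Complex.exp (-(t * (σ + y * Complex.I))) * D t = 0)
    {t : ℝ} (ht : 0 < t) (hc : ContinuousAt D t) : D t = 0 := by
  -- The Fourier transform of `e^{-σt} D(t)`, extended by zero, is the Laplace transform along the
  -- line `Re = σ`. It vanishes identically, so inversion applies trivially.
  set E : ℝ → ℂ := (Ioi (0 : ℝ)).indicator fun t : ℝ => Complex.exp (-(t * σ)) * D t with hE
  have hEi : Integrable E := (integrable_indicator_iff measurableSet_Ioi).2 hD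
  have hF : FourierTransform.fourier E = 0 := by
    ext w
    rw [Real.fourier_real_eq_integral_exp_smul, Pi.zero_apply, ← h0 (2 * Real.pi * w),
      ← integral_indicator measurableSet_Ioi]
    congr 1
    ext v
    by_cases hv : v ∈ Ioi (0 : ℝ)
    · rw [hE, indicator_of_mem hv, indicator_of_mem hv, smul_eq_mul, ← mul_assoc, ← Complex.exp_add]
      push_cast
      ring_nf
    · rw [hE, indicator_of_notMem hv, indicator_of_notMem hv, smul_zero]
  have hEc : ContinuousAt E t := by
    have h1 : ContinuousAt (fun t : ℝ => Complex.exp (-(t * σ)) * D t) t :=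
      ContinuousAt.mul (by fun_prop) hc
    refine h1.congr ?_
    filter_upwards [Ioi_mem_nhds ht] with u hu
    rw [hE, indicator_of_mem hu]
  have := hEi.fourierInv_fourier_eq (by rw [hF]; exact integrable_zero _ _ _) hEc
  rw [hF] at this
  have h2 : FourierTransformInv.fourierInv (0 : ℝ → ℂ) t = 0 := by
    simp [Real.fourierInv_eq]
  rw [h2, hE, indicator_of_mem (show t ∈ Ioi (0 : ℝ) from ht)] at this
  exact (mul_eq_zero.1 this.symm).resolve_left (Complex.exp_ne_zero _)

/-- The Laplace transform of a primitive. -/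
lemma laplace_primitive {g : ℝ → ℂ} {S : ℂ} (hS : 0 < S.re)
    (hg : IntegrableOn (fun t : ℝ => Complex.exp (-(t * S)) * g t) (Ioi 0)) :
    IntegrableOn (fun t : ℝ => Complex.exp (-(t * S)) * ∫ u in (0 : ℝ)..t, g u) (Ioi 0) ∧
    ∫ t in Ioi (0 : ℝ), Complex.exp (-(t * S)) * ∫ u in (0 : ℝ)..t, g u = laplace g S / S := by
  have he : IntegrableOn (fun t : ℝ => Complex.exp (-S * t)) (Ioi 0) :=
    integrableOn_exp_mul_complex_Ioi (by simpa using hS) 0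
  -- The damped primitive is the half-line convolution of `e^{-uS} g(u)` with `e^{-uS}`, whose
  -- integrals multiply.
  have hconv : ∀ t : ℝ, ∫ u in (0 : ℝ)..t, ContinuousLinearMap.mul ℝ ℂ
      (Complex.exp (-(u * S)) * g u) (Complex.exp (-S * (t - u : ℝ))) =
      Complex.exp (-(t * S)) * ∫ u in (0 : ℝ)..t, g u := by
    intro t
    rw [← intervalIntegral.integral_const_mul]
    refine intervalIntegral.integral_congr fun u _ => ?_
    simp only [ContinuousLinearMap.mul_apply']
    rw [mul_right_comm, ← Complex.exp_add]
    push_cast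
    ring_nf
  constructor
  · have := integrable_posConvolution hg he (ContinuousLinearMap.mul ℝ ℂ)
    rw [posConvolution, integrable_indicator_iff measurableSet_Ioi] at this
    simpa only [hconv] using this
  · have := integral_posConvolution hg he (ContinuousLinearMap.mul ℝ ℂ)
    simp only [hconv] at this
    rw [this, integral_exp_mul_complex_Ioi (by simpa using hS)]
    simp [laplace, div_eq_mul_inv]

/-- Analyticity on `(0, ∞)` says nothing near `0`; integrability there comes from the Laplace
integral. -/
lemma intervalIntegrable_of_laplace {g : ℝ → ℂ} {S : ℂ}
    (hg : IntegrableOn (fun t : ℝ => Complex.exp (-(t * S)) * g t) (Ioi 0)) {T : ℝ} (hT : 0 ≤ T) :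
    IntervalIntegrable g volume 0 T := by
  rw [intervalIntegrable_iff_integrableOn_Ioc_of_le hT]
  have h1 : IntegrableOn (fun t : ℝ => Complex.exp (t * S) * (Complex.exp (-(t * S)) * g t))
      (Ioc 0 T) := by
    have h2 : Continuous fun t : ℝ => Complex.exp (t * S) := by fun_prop
    obtain ⟨M, hM⟩ := (isCompact_Icc (a := 0) (b := T)).exists_bound_of_continuousOn h2.continuousOn
    refine Integrable.bdd_mul (c := M) (hg.mono_set Ioc_subset_Ioi_self) h2.aestronglyMeasurable ?_
    filter_upwards [ae_restrict_mem measurableSet_Ioc] with t ht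
    exact hM t (Ioc_subset_Icc_self ht)
  refine h1.congr (Eventually.of_forall fun t => ?_)
  beta_reduce
  rw [← mul_assoc, ← Complex.exp_add, add_neg_cancel, Complex.exp_zero, one_mul]

lemma rayIntegralInfty_expKernel (δ θ : ℝ) (C : ℂ → ℂ) (z : ℂ) :
    rayIntegralInfty δ θ (expKernel C z) =
      expIntegral (volume.restrict (Ioi δ)) (fun t => Complex.exp (polarLog t θ))
        (fun t => (2 * Real.pi * Complex.I)⁻¹ * Complex.exp (θ * Complex.I) *
          C (polarLog t θ)) z := by
  rw [rayIntegralInfty, ← integral_const_mul, expIntegral]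
  congr 1
  ext t
  rw [expKernel]
  ring

lemma cos_neg_of_abs {θ : ℝ} (h : 3 * Real.pi / 4 ≤ |θ|) (h' : |θ| ≤ Real.pi) :
    Real.cos θ < 0 := by
  rw [← Real.cos_abs]
  have := Real.pi_pos
  exact Real.cos_neg_of_pi_div_two_lt_of_lt (by linarith) (by linarith)

lemma exp_polarLog_re {t : ℝ} (ht : 0 < t) (θ : ℝ) :
    (Complex.exp (polarLog t θ)).re = t * Real.cos θ := by
  rw [exp_polarLog ht, Complex.re_ofReal_mul, Complex.exp_ofReal_mul_I_re]

lemma integrableOn_inv_sq {δ : ℝ} (hδ : 0 < δ) (A : ℝ) :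
    IntegrableOn (fun t : ℝ => A / t ^ 2) (Ioi δ) := by
  have : IntegrableOn (fun t : ℝ => A * t ^ (-2 : ℝ)) (Ioi δ) :=
    (integrableOn_Ioi_rpow_of_lt (by norm_num : (-2 : ℝ) < -1) hδ).const_mul A
  refine this.congr_fun (fun t ht => ?_) measurableSet_Ioi
  have ht0 : 0 < t := hδ.trans ht
  beta_reduce
  rw [Real.rpow_neg ht0.le, div_eq_mul_inv]
  norm_num

/-- Coefficients with the decay of `1 / s`: the Laplace transform of the integral over the angular
contour. -/
lemma laplace_angularIntegral {δ ψ M M' : ℝ} {C : ℂ → ℂ} (hC : IsCoeff δ ψ M C)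
    (hdec : ∀ w ∈ coeffRegion δ ψ, ‖C w‖ ≤ M' * Real.exp (-w.re)) (hδ : 0 < δ)
    (hψ : 3 * Real.pi / 4 < ψ) (hψ' : ψ ≤ Real.pi) {S : ℂ} (hS : δ < S.re) :
    IntegrableOn (fun t : ℝ => Complex.exp (-(t * S)) *
      angularIntegral δ ψ (expKernel C t)) (Ioi 0) ∧
    ∫ t in Ioi (0 : ℝ), Complex.exp (-(t * S)) * angularIntegral δ ψ (expKernel C t) =
      angularIntegral δ ψ (fun w => C w / (S - Complex.exp w)) := by
  have hψ0 : 0 < ψ := lt_trans (by positivity) hψ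
  have hp : Continuous fun θ : ℝ => polarLog δ θ := by unfold polarLog; fun_prop
  -- the arc
  have harc := hC.isExpData_arc hδ (lt_add_one δ)
  have hre : ∀ θ : ℝ, (Complex.exp (polarLog δ θ)).re ≤ δ := fun θ => by
    refine (Complex.re_le_norm _).trans ?_
    rw [norm_exp_eq, polarLog_re, Real.exp_log hδ]
  obtain ⟨a1, a2⟩ := laplace_expIntegral (S := S) harc.aesm harc.integrable.aestronglyMeasurable
    (Eventually.of_forall fun θ => (hre θ).trans_lt hS) (by
      refine (harc.integrable.norm.div_const (S.re - δ)).mono'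
        (AEMeasurable.aestronglyMeasurable ?_) (Eventually.of_forall fun θ => ?_)
      · exact harc.integrable.norm.aemeasurable.div
          (aemeasurable_const.sub (Complex.measurable_re.comp_aemeasurable harc.aesm.aemeasurable))
      · have h1 := hre θ
        have h2 : 0 < S.re - δ := by linarith
        have h3 : S.re - δ ≤ S.re - (Complex.exp (polarLog δ θ)).re := by linarith
        rw [Real.norm_of_nonneg (div_nonneg (norm_nonneg _) (h2.le.trans h3))]
        gcongr)
  -- the rays
  have hray : ∀ θ : ℝ, |θ| = ψ →
      IntegrableOn (fun t : ℝ => Complex.exp (-(t * S)) *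
        rayIntegralInfty δ θ (expKernel C t)) (Ioi 0) ∧
      ∫ t in Ioi (0 : ℝ), Complex.exp (-(t * S)) * rayIntegralInfty δ θ (expKernel C t) =
        rayIntegralInfty δ θ (fun w => C w / (S - Complex.exp w)) := by
    intro θ hθ
    -- The rays point into the left half-plane, so `Re S - Re s ≥ t |cos θ|`. With the `1/t` decay
    -- of `C` this gives an integrable `1/t²`.
    have hcos := cos_neg_of_abs (hθ ▸ hψ.le) (hθ ▸ hψ')
    have hcC := (hC.continuousOn_ray hδ hθ.le (by rw [hθ]; exact hψ.le)).mono Ioi_subset_Ici_self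
    have hsm : AEStronglyMeasurable (fun t => Complex.exp (polarLog t θ))
        (volume.restrict (Ioi δ)) :=
      ((continuousOn_polarLog hδ θ).mono Ioi_subset_Ici_self).cexp.aestronglyMeasurable
        measurableSet_Ioi
    have hcm : AEStronglyMeasurable (fun t => (2 * Real.pi * Complex.I)⁻¹ *
        Complex.exp (θ * Complex.I) * C (polarLog t θ)) (volume.restrict (Ioi δ)) :=
      (continuousOn_const.mul hcC).aestronglyMeasurable measurableSet_Ioi
    obtain ⟨r1, r2⟩ := laplace_expIntegral (S := S) hsm hcm (by
        filter_upwards [ae_restrict_mem measurableSet_Ioi] with t ht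
        rw [exp_polarLog_re (hδ.trans ht)]
        have : t * Real.cos θ < 0 := mul_neg_of_pos_of_neg (hδ.trans ht) hcos
        linarith) (by
      refine (integrableOn_inv_sq hδ (M' / -Real.cos θ)).mono'
        (AEMeasurable.aestronglyMeasurable ?_) ?_
      · exact hcm.norm.aemeasurable.div
          (aemeasurable_const.sub (Complex.measurable_re.comp_aemeasurable hsm.aemeasurable))
      · filter_upwards [ae_restrict_mem measurableSet_Ioi] with t ht
        have ht0 : 0 < t := hδ.trans ht
        have h4 : 0 < t * -Real.cos θ := mul_pos ht0 (neg_pos.2 hcos)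
        have h5 : t * -Real.cos θ ≤ S.re - (Complex.exp (polarLog t θ)).re := by
          rw [exp_polarLog_re ht0]
          linarith
        have h6 : ‖C (polarLog t θ)‖ ≤ M' / t := by
          have := hdec _ (ray_mem_coeffRegion hδ hθ.le (by rw [hθ]; exact hψ.le) (le_of_lt ht))
          rwa [polarLog_re, Real.exp_neg, Real.exp_log ht0, ← div_eq_mul_inv] at this
        have h7 : ‖(2 * Real.pi * Complex.I)⁻¹ * Complex.exp (θ * Complex.I) * C (polarLog t θ)‖ ≤
            M' / t := by
          rw [norm_mul, norm_mul, Complex.norm_exp_ofReal_mul_I, mul_one]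
          exact (mul_le_of_le_one_left (norm_nonneg _) norm_two_pi_I_inv_le).trans h6
        rw [Real.norm_of_nonneg (div_nonneg (norm_nonneg _) (h4.le.trans h5))]
        calc _ ≤ (M' / t) / (t * -Real.cos θ) := by
                gcongr
                exact (norm_nonneg _).trans h7
          _ = _ := by
            have := hcos.ne
            field_simp)
    simp only [rayIntegralInfty_expKernel]
    refine ⟨r1, r2.trans ?_⟩
    rw [cauchyTransform, rayIntegralInfty, ← integral_const_mul]
    congr 1
    ext t
    ring
  obtain ⟨p1, p2⟩ := hray ψ (abs_of_pos hψ0)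
  obtain ⟨n1, n2⟩ := hray (-ψ) (by rw [abs_neg, abs_of_pos hψ0])
  rw [← arcIntegral_expKernel hψ0] at a1 a2
  beta_reduce at a1 a2
  have key : ∀ t : ℝ, Complex.exp (-(t * S)) * angularIntegral δ ψ (expKernel C t) =
      Complex.exp (-(t * S)) * arcIntegral δ ψ (expKernel C t) +
      Complex.exp (-(t * S)) * rayIntegralInfty δ ψ (expKernel C t) -
      Complex.exp (-(t * S)) * rayIntegralInfty δ (-ψ) (expKernel C t) := fun t => by
    rw [angularIntegral_eq]
    ring
  simp only [key]
  have ap : IntegrableOn (fun t : ℝ => Complex.exp (-(t * S)) * arcIntegral δ ψ (expKernel C t) +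
      Complex.exp (-(t * S)) * rayIntegralInfty δ ψ (expKernel C t)) (Ioi 0) := a1.add p1
  refine ⟨ap.sub n1, ?_⟩
  rw [integral_sub ap n1, integral_add a1 p1, a2, p2, n2, angularIntegral_eq]
  congr 2
  rw [cauchyTransform, arcIntegral, intervalIntegral.integral_of_le (by linarith),
    ← integral_const_mul]
  congr 1
  ext θ
  ring

/-! ### The source is recovered from its Laplace transform -/

/-- Cauchy's formula for the reciprocal kernel `1 / (S - s)` in the variable `w = log s`. -/
lemma rectIntegral_div_sub_exp {a b ψ : ℝ} (hψ' : ψ ≤ Real.pi) {F : ℂ → ℂ}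
    (hF : ContinuousOn F (Icc a b ×ℂ Icc (-ψ) ψ))
    (hd : DifferentiableOn ℂ F (Ioo a b ×ℂ Ioo (-ψ) ψ)) {S : ℂ}
    (hS : S ≠ 0) (hSarg : |S.arg| < Real.pi / 2)
    (hmem : Complex.log S ∈ Ioo a b ×ℂ Ioo (-ψ) ψ) :
    rectIntegral a b (-ψ) ψ (fun w => F w / (S - Complex.exp w)) =
      -(2 * Real.pi * Complex.I * (F (Complex.log S) / S)) := by
  set w₀ := Complex.log S with hw₀
  have hab : a ≤ b := (hmem.1.1.trans hmem.1.2).le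
  have hcd : -ψ ≤ ψ := (hmem.2.1.trans hmem.2.2).le
  have hexp : Complex.exp w₀ = S := Complex.exp_log hS
  -- `e^w - S = q(w) (w - w₀)`, so the kernel is `-1/q` times a simple pole at `w₀`. The quotient
  -- `q` has no zero in the strip: `e^w = S` forces `Im w - arg S ∈ 2πℤ`, while `|Im w| ≤ π` and
  -- `|arg S| < π/2`. Cauchy's formula is then applied to `-F/q`, with `q w₀ = S`.
  set q : ℂ → ℂ := dslope Complex.exp w₀ with hq
  have hqd : Differentiable ℂ q := by
    rw [← differentiableOn_univ]
    exact (Complex.differentiableOn_dslope univ_mem).2 Complex.differentiable_exp.differentiableOn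
  have hq₀ : q w₀ = S := by
    rw [hq, dslope_same, Complex.deriv_exp, hexp]
  have hq_ne : ∀ w, w ≠ w₀ → q w = (Complex.exp w - S) / (w - w₀) := fun w hw => by
    rw [hq, dslope_of_ne _ hw, slope_def_field, hexp]
  have hne : ∀ w : ℂ, |w.im| ≤ ψ → q w ≠ 0 := by
    intro w hw h0
    by_cases hww : w = w₀
    · rw [hww, hq₀] at h0
      exact hS h0
    rw [hq_ne w hww, div_eq_zero_iff, sub_eq_zero, ← hexp] at h0
    rcases h0 with h0 | h0
    · obtain ⟨n, hn⟩ := Complex.exp_eq_exp_iff_exists_int.1 h0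
      have him := congrArg Complex.im hn
      simp at him
      have h1 : w₀.im = S.arg := Complex.log_im S
      rw [h1] at him
      obtain ⟨c1, c2⟩ := abs_lt.1 hSarg
      obtain ⟨c3, c4⟩ := abs_le.1 hw
      have hpi := Real.pi_pos
      have hn1 : (n : ℝ) < 1 := by
        by_contra! hlt
        nlinarith
      have hn2 : (-1 : ℝ) < n := by
        by_contra! hlt
        nlinarith
      have hn0 : n = 0 := by
        have h2 : n < 1 := by exact_mod_cast hn1
        have h3 : -1 < n := by exact_mod_cast hn2
        omega
      rw [hn0] at hn
      exact hww (by simpa using hn)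
    · exact hww (sub_eq_zero.1 h0)
  have key := rectIntegral_div_sub (f := fun w => -F w / q w)
    (hF.neg.div hqd.continuous.continuousOn fun w hw => hne w (abs_le.2 hw.2))
    (hd.neg.div hqd.differentiableOn fun w hw => hne w (abs_le.2 ⟨hw.2.1.le, hw.2.2.le⟩)) hmem
  rw [rectIntegral_congr hab hcd (g := fun w => -F w / q w / (w - w₀)), key, hq₀]
  · ring
  · intro w hw
    have hww : w ≠ w₀ := by
      rintro rfl
      exact hw.2 hmem
    have h1 : w - w₀ ≠ 0 := sub_ne_zero.2 hww
    rw [hq_ne w hww, div_div, div_mul_cancel₀ _ h1, ← neg_sub S, neg_div_neg_eq]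

/-- Cauchy's formula for the angular contour. -/
lemma angularIntegral_cauchy {δ ψ M : ℝ} {F : ℂ → ℂ} (hδ : 0 < δ) (hψ : 3 * Real.pi / 4 < ψ)
    (hψ' : ψ ≤ Real.pi) (hF : ContinuousOn F (closedHalfStrip δ ψ))
    (hd : DifferentiableOn ℂ F (openHalfStrip δ ψ)) (hM : ∀ w ∈ closedHalfStrip δ ψ, ‖F w‖ ≤ M)
    {S : ℂ} (hS : δ < S.re) :
    angularIntegral δ ψ (fun w => F w / Complex.exp w / (S - Complex.exp w)) =
      F (Complex.log S) / S := by
  have hpi := Real.pi_pos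
  have hψ0 : 0 < ψ := lt_trans (by positivity) hψ
  have hS0 : 0 < S.re := hδ.trans hS
  have hSne : S ≠ 0 := fun h => by simp [h] at hS0
  have hSarg : |S.arg| < Real.pi / 2 := Complex.abs_arg_lt_pi_div_two_iff.2 (Or.inl hS0)
  have hSn : δ < ‖S‖ := hS.trans_le (Complex.re_le_norm S)
  set H : ℂ → ℂ := fun w => F w / Complex.exp w / (S - Complex.exp w) with hH
  have hM0 : 0 ≤ M := (norm_nonneg _).trans
    (hM (Complex.log S) ⟨by rw [Complex.log_re]; exact Real.log_le_log hδ hSn.le,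
      by rw [Complex.log_im]; linarith⟩)
  -- the rays
  have hray : ∀ θ : ℝ, |θ| = ψ → ContinuousOn (fun t => H (polarLog t θ)) (Ici δ) ∧
      IntegrableOn (fun t => H (polarLog t θ)) (Ioi δ) := by
    intro θ hθ
    have hcos := cos_neg_of_abs (hθ ▸ hψ.le) (hθ ▸ hψ')
    have hgap : ∀ t, δ ≤ t → t * -Real.cos θ ≤ ‖S - Complex.exp (polarLog t θ)‖ := by
      intro t ht
      refine le_trans ?_ (Complex.re_le_norm _)
      rw [Complex.sub_re, exp_polarLog_re (hδ.trans_le ht)]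
      linarith
    have hmem : ∀ t ∈ Ici δ, polarLog t θ ∈ closedHalfStrip δ ψ := fun t ht =>
      ⟨by rw [polarLog_re]; exact Real.log_le_log hδ ht, by rw [polarLog_im]; exact hθ.le⟩
    have hcont : ContinuousOn (fun t => H (polarLog t θ)) (Ici δ) := by
      have h1 := continuousOn_polarLog hδ θ
      refine ContinuousOn.div (ContinuousOn.div (hF.comp h1 hmem) h1.cexp
        fun _ _ => Complex.exp_ne_zero _) (continuousOn_const.sub h1.cexp) fun t ht => ?_
      rw [← norm_pos_iff]
      exact (mul_pos (hδ.trans_le ht) (neg_pos.2 hcos)).trans_le (hgap t ht)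
    refine ⟨hcont, (integrableOn_inv_sq hδ (M / -Real.cos θ)).mono'
      ((hcont.mono Ioi_subset_Ici_self).aestronglyMeasurable measurableSet_Ioi) ?_⟩
    filter_upwards [ae_restrict_mem measurableSet_Ioi] with t ht
    have ht0 : 0 < t := hδ.trans ht
    have h4 : 0 < t * -Real.cos θ := mul_pos ht0 (neg_pos.2 hcos)
    have h5 := hM _ (hmem t (mem_Ici.2 (le_of_lt ht)))
    have h6 := hgap t (le_of_lt ht)
    simp only [hH]
    rw [norm_div, norm_div, norm_exp_eq, polarLog_re, Real.exp_log ht0]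
    calc _ ≤ M / t / (t * -Real.cos θ) := by gcongr
      _ = _ := by
        have := hcos.ne
        field_simp
  obtain ⟨pc, pi⟩ := hray ψ (abs_of_pos hψ0)
  obtain ⟨nc, ni⟩ := hray (-ψ) (by rw [abs_neg, abs_of_pos hψ0])
  have hlim : Tendsto (fun ρ => truncatedIntegral δ ψ ρ H) atTop (𝓝 (angularIntegral δ ψ H)) := by
    have h1 : ∀ θ : ℝ, IntegrableOn (fun t => H (polarLog t θ)) (Ioi δ) →
        Tendsto (fun ρ => rayIntegral δ ρ θ H) atTop (𝓝 (rayIntegralInfty δ θ H)) := fun θ hi =>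
      (intervalIntegral_tendsto_integral_Ioi δ (hi.mul_const _) tendsto_id).const_mul _
    simp only [truncatedIntegral_eq, angularIntegral_eq]
    exact (tendsto_const_nhds.add (h1 _ pi)).sub (h1 _ ni)
  -- the large arc
  have harc : Tendsto (fun ρ => arcSegment ρ (-ψ) ψ H) atTop (𝓝 0) := by
    -- On `|s| = ρ` the integrand is at most `(M / ρ) / (ρ - ‖S‖)`, and the arc has length `2ψρ`.
    have h1 : Tendsto (fun ρ : ℝ => M * (ρ - ‖S‖)⁻¹ * (ψ - -ψ)) atTop (𝓝 0) := by
      have := (tendsto_inv_atTop_zero.comp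
        (tendsto_atTop_add_const_right atTop (-‖S‖) tendsto_id)).const_mul M |>.mul_const (ψ - -ψ)
      simpa [Function.comp_def, sub_eq_add_neg] using this
    refine squeeze_zero_norm' ?_ h1
    filter_upwards [eventually_gt_atTop ‖S‖] with ρ hρ
    have hρδ : δ < ρ := hSn.trans hρ
    have hρ0 : 0 < ρ := hδ.trans hρδ
    have h2 := norm_arcSegment_le (H := H) (B := M / ρ / (ρ - ‖S‖)) hρ0 (by linarith : -ψ ≤ ψ)
      fun θ hθ => ?_
    · refine h2.trans (le_of_eq ?_)
      have : ρ - ‖S‖ ≠ 0 := (sub_pos.2 hρ).ne'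
      field_simp
    · have h3 : ‖Complex.exp (polarLog ρ θ)‖ = ρ := by
        rw [norm_exp_eq, polarLog_re, Real.exp_log hρ0]
      have h4 : ρ - ‖S‖ ≤ ‖S - Complex.exp (polarLog ρ θ)‖ := by
        have := norm_sub_norm_le (Complex.exp (polarLog ρ θ)) S
        rwa [h3, norm_sub_rev] at this
      have h5 := hM (polarLog ρ θ) ⟨by rw [polarLog_re]; exact Real.log_le_log hδ hρδ.le,
        by rw [polarLog_im]; exact abs_le.2 hθ⟩
      have h6 : 0 < ρ - ‖S‖ := sub_pos.2 hρ
      simp only [hH]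
      rw [norm_div, norm_div, h3]
      gcongr
  -- Once `ρ > ‖S‖`, the point `log S` lies inside the rectangle, and the residue there produces
  -- `F(log S)/S`.
  have hev : ∀ᶠ ρ in atTop, truncatedIntegral δ ψ ρ H =
      F (Complex.log S) / S + arcSegment ρ (-ψ) ψ H := by
    filter_upwards [eventually_gt_atTop ‖S‖] with ρ hρ
    have hρδ : δ < ρ := hSn.trans hρ
    have hρ0 : 0 < ρ := hδ.trans hρδ
    have h1 := rect_eq_contours hδ hρδ.le nc pc
    have h2 : (fun w => H w * Complex.exp w) = fun w => F w / (S - Complex.exp w) := by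
      ext w
      simp only [hH]
      rw [div_right_comm, div_mul_cancel₀ _ (Complex.exp_ne_zero w)]
    rw [h2, rectIntegral_div_sub_exp hψ' (hF.mono fun w hw => ⟨hw.1.1, abs_le.2 hw.2⟩)
      (hd.mono fun w hw => ⟨hw.1.1, abs_lt.2 hw.2⟩) hSne hSarg ?_] at h1
    · have h3 : (2 * Real.pi * Complex.I : ℂ) ≠ 0 := Complex.two_pi_I_ne_zero
      rw [mul_neg, inv_mul_cancel_left₀ h3] at h1
      have h4 : arcSegment δ (-ψ) ψ H = arcIntegral δ ψ H := rfl
      rw [truncatedIntegral_eq, ← h4]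
      linear_combination -h1
    · refine ⟨?_, ?_⟩
      · show (Complex.log S).re ∈ Ioo _ _
        rw [Complex.log_re]
        exact ⟨Real.log_lt_log hδ hSn, Real.log_lt_log (hδ.trans hSn) hρ⟩
      · show (Complex.log S).im ∈ Ioo _ _
        rw [Complex.log_im]
        exact abs_lt.1 (by linarith)
  refine tendsto_nhds_unique hlim ((Tendsto.congr' (EventuallyEq.symm hev)
    (tendsto_const_nhds.add harc)).trans ?_)
  rw [add_zero]

namespace IsSource

variable {g : ℝ → ℂ} {δ ψ : ℝ} {F : ℂ → ℂ}

lemma coeffRegion_subset : coeffRegion δ ψ ⊆ closedHalfStrip δ ψ := fun _ hw => ⟨hw.1, hw.2.1⟩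

lemma exists_isCoeff (hg : IsSource g δ ψ F) : ∃ M : ℝ, IsCoeff δ ψ M F := by
  obtain ⟨M, hM⟩ := hg.bounded
  exact ⟨M, hg.continuousOn.mono coeffRegion_subset, fun w hw => hM w (coeffRegion_subset hw)⟩

lemma ofReal_mem_angularRegion (hψ : 3 * Real.pi / 4 < ψ) {t : ℝ} (ht : 0 < t) :
    (t : ℂ) ∈ angularRegion ψ := by
  refine ⟨by exact_mod_cast ht.ne', ?_⟩
  rw [Complex.arg_ofReal_of_nonneg ht.le, abs_zero]
  linarith [Real.pi_pos]

/-- The contour integral of `e^{st} L(g)(s)` recovers the source on the positive half-axis. -/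
lemma gInfty_eq (hg : IsSource g δ ψ F) (hδ : 0 < δ) (hψ : 3 * Real.pi / 4 < ψ)
    (hψ' : ψ ≤ Real.pi) {t : ℝ} (ht : 0 < t) : gInfty δ ψ F t = g t := by
  obtain ⟨M, hM⟩ := hg.bounded
  obtain ⟨a, ha1, ha2⟩ := hg.laplace_eq
  have hCF : IsCoeff δ ψ M F :=
    ⟨hg.continuousOn.mono coeffRegion_subset, fun w hw => hM w (coeffRegion_subset hw)⟩
  -- Dividing by `s` gains the decay `1/|s|` that `F` alone lacks; on the side of the source it
  -- corresponds to taking the primitive.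
  set C : ℂ → ℂ := fun w => F w / Complex.exp w with hCdef
  have hCe : (fun w => Complex.exp w * C w) = F := by
    ext w
    exact mul_div_cancel₀ _ (Complex.exp_ne_zero w)
  have hdec : ∀ w ∈ coeffRegion δ ψ, ‖C w‖ ≤ M * Real.exp (-w.re) := by
    intro w hw
    rw [hCdef, norm_div, norm_exp_eq, Real.exp_neg, div_eq_mul_inv]
    exact mul_le_mul_of_nonneg_right (hCF.bound w hw) (inv_nonneg.2 (Real.exp_pos _).le)
  have hC : IsCoeff δ ψ (M * Real.exp (-Real.log δ)) C := by
    refine ⟨hCF.continuousOn.div Complex.continuous_exp.continuousOn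
      fun w _ => Complex.exp_ne_zero w, fun w hw => (hdec w hw).trans ?_⟩
    have := (norm_nonneg _).trans (hCF.bound w hw)
    have := hw.1
    gcongr
  -- The line `Re S = σ` lies in the half-plane of convergence and to the right of the arc.
  set σ : ℝ := max a δ + 1 with hσ
  have hσa : a < σ := (le_max_left _ _).trans_lt (lt_add_one _)
  have hσδ : δ < σ := (le_max_right _ _).trans_lt (lt_add_one _)
  have hσ0 : 0 < σ := hδ.trans hσδ
  set G : ℝ → ℂ := fun t => ∫ u in (0 : ℝ)..t, g u with hG
  set K : ℂ → ℂ := fun z => angularIntegral δ ψ (expKernel C z) with hK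
  have hGd : ∀ t : ℝ, 0 < t → HasDerivAt G (g t) t := by
    intro t ht
    have hgc : ∀ x ∈ Ioi (0 : ℝ), ContinuousAt g x := fun x hx => (hg.analytic x hx).continuousAt
    exact intervalIntegral.integral_hasDerivAt_right
      (intervalIntegrable_of_laplace (ha1 σ (by simpa using hσa)) ht.le)
      (ContinuousAt.stronglyMeasurableAtFilter isOpen_Ioi hgc t ht) (hgc t ht)
  have hKd : ∀ t : ℝ, 0 < t → HasDerivAt (fun t : ℝ => K t) (gInfty δ ψ F t) t := by
    intro t ht
    have := hC.hasDerivAt_angularIntegral (M' := M) (by rw [hCe]; exact hCF) hδ hψ hψ'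
      (ofReal_mem_angularRegion hψ ht)
    rw [hCe] at this
    exact this.comp_ofReal
  have hzero : ∀ t : ℝ, 0 < t → G t - K t = 0 := by
    intro t ht
    have hLap : ∀ y : ℝ, IntegrableOn (fun t : ℝ => Complex.exp (-(t * (σ + y * Complex.I))) *
        (G t - K t)) (Ioi 0) ∧
        ∫ t in Ioi (0 : ℝ), Complex.exp (-(t * (σ + y * Complex.I))) * (G t - K t) = 0 := by
      intro y
      set S : ℂ := σ + y * Complex.I with hSdef
      have hSre : S.re = σ := by simp [hSdef]
      have hSne : S ≠ 0 := fun h => by rw [h, Complex.zero_re] at hSre; exact hσ0.ne hSre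
      obtain ⟨g1, g2⟩ := laplace_primitive (S := S) (by rw [hSre]; exact hσ0)
        (ha1 S (by rw [hSre]; exact hσa))
      obtain ⟨k1, k2⟩ := laplace_angularIntegral hC hdec hδ hψ hψ' (S := S) (by rw [hSre]; exact hσδ)
      have h3 := angularIntegral_cauchy hδ hψ hψ' hg.continuousOn hg.differentiableOn hM (S := S)
        (by rw [hSre]; exact hσδ)
      have h4 : F (Complex.log S) = laplace g S := by
        have := ha2 (Complex.log S) ⟨?_, ?_⟩ ?_
        · rwa [Complex.exp_log hSne] at this
        · rw [Complex.log_re]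
          refine Real.log_le_log hδ ?_
          have := Complex.re_le_norm S
          linarith
        · rw [Complex.log_im]
          have := Complex.abs_arg_lt_pi_div_two_iff.2 (Or.inl (by rw [hSre]; exact hσ0) :
            0 < S.re ∨ S = 0)
          linarith [Real.pi_pos]
        · rw [Complex.exp_log hSne, hSre]
          exact hσa
      simp only [mul_sub]
      refine ⟨g1.sub k1, ?_⟩
      rw [integral_sub g1 k1, g2, k2, h3, h4, sub_self]
    refine eq_zero_of_laplace_eq_zero (D := fun t : ℝ => G t - K t) (σ := σ) ?_
      (fun y => (hLap y).2) ht ((hGd t ht).continuousAt.sub (hKd t ht).continuousAt)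
    simpa using (hLap 0).1
  -- The primitive of `g` and `K` coincide on `(0, ∞)`, hence so do their derivatives `g t` and
  -- `gInfty δ ψ F t`.
  refine (hKd t ht).unique ((hGd t ht).congr_of_eventuallyEq ?_)
  filter_upwards [Ioi_mem_nhds ht] with u hu
  exact (sub_eq_zero.1 (hzero u hu)).symm

end IsSource

/-! ### The symbol -/

/-- `1/ζ(s) = ∑ μ(n) n^{-s}` for `Re s > 1`, and each term has its largest modulus on `Re s ≥ σ` at
`s = σ`. -/
lemma exists_norm_inv_riemannZeta_le {σ : ℝ} (hσ : 1 < σ) :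
    ∃ B : ℝ, ∀ s : ℂ, σ ≤ s.re → ‖(riemannZeta s)⁻¹‖ ≤ B := by
  set μ : ℕ → ℂ := fun n => (ArithmeticFunction.moebius n : ℂ)
  have hsum : ∀ s : ℂ, 1 < s.re → LSeriesSummable μ s := fun s hs =>
    ArithmeticFunction.LSeriesSummable_moebius_iff.2 hs
  refine ⟨∑' n, ‖LSeries.term μ σ n‖, fun s hs => ?_⟩
  have hs1 : 1 < s.re := hσ.trans_le hs
  have h1 : riemannZeta s * LSeries μ s = 1 := by
    rw [← LSeries_one_eq_riemannZeta hs1]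
    exact LSeries_one_mul_Lseries_moebius hs1
  rw [inv_eq_of_mul_eq_one_right h1, LSeries]
  exact (norm_tsum_le_tsum_norm (hsum s hs1).norm).trans
    ((hsum s hs1).norm.tsum_le_tsum (LSeries.norm_term_le_of_re_le_re μ (by simpa using hs))
      (hsum σ (by simpa using hσ)).norm)

/-- The pole of `ζ` corresponds to `s = ±i √(h - 1)`, the endpoints of the half-lines removed in
`slitDomain`. -/
lemma differentiableOn_zetaSymbol {h : ℝ} (hh : 1 < h) :
    DifferentiableOn ℂ (zetaSymbol h) (leftAngularDomain h) := by
  intro s hs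
  have hne : s ^ 2 + h ≠ 1 := by
    intro heq
    have hR : 0 < h - 1 := by linarith
    have h1 : s ^ 2 = ((Real.sqrt (h - 1) : ℂ) * Complex.I) ^ 2 := by
      rw [mul_pow, Complex.I_sq, ← Complex.ofReal_pow, Real.sq_sqrt hR.le]
      push_cast
      linear_combination heq
    refine leftAngularDomain_subset_slitDomain hs ?_
    rcases sq_eq_sq_iff_eq_or_eq_neg.1 h1 with h2 | h2
    · rw [h2]
      exact ⟨by simp, by simp [abs_of_nonneg (Real.sqrt_nonneg (h - 1))]⟩
    · rw [h2]
      exact ⟨by simp, by simp [abs_of_nonneg (Real.sqrt_nonneg (h - 1))]⟩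
  exact ((differentiableAt_riemannZeta hne).comp s
    (f := fun s : ℂ => s ^ 2 + (h : ℂ)) (by fun_prop)).differentiableWithinAt

/-- Squaring sends `[3π/4, π]` to `[3π/2, 2π]`, where the cosine is nonnegative. This is the origin
of the angle `3π/4`. -/
lemma re_exp_sq_nonneg {w : ℂ} (h : 3 * Real.pi / 4 ≤ |w.im|) (h' : |w.im| ≤ Real.pi) :
    0 ≤ (Complex.exp w ^ 2).re := by
  have h1 : Complex.exp w ^ 2 = Complex.exp (2 * w) := by
    rw [← Complex.exp_nat_mul]
    norm_num
  have h2 : (2 * w).im = 2 * w.im := by simp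
  have hpi := Real.pi_pos
  rw [h1, Complex.exp_re, h2]
  refine mul_nonneg (Real.exp_pos _).le ?_
  rw [← Real.cos_abs, abs_mul, abs_two, ← Real.cos_sub_two_pi]
  exact Real.cos_nonneg_of_neg_pi_div_two_le_of_le (by linarith) (by linarith)

/-- On the arc `|s²| = δ²`; on the sectors `Re s² ≥ 0`. The bound exceeds `1` precisely when `δ² < h
- 1`. -/
lemma re_symbol_ge {h δ ψ : ℝ} (hψ' : ψ ≤ Real.pi) (hδ : 0 < δ) {w : ℂ}
    (hw : w ∈ coeffRegion δ ψ) : h - δ ^ 2 ≤ (Complex.exp w ^ 2 + h).re := by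
  rw [Complex.add_re, Complex.ofReal_re]
  rcases hw.2.2 with h1 | h1
  · have h2 : ‖Complex.exp w ^ 2‖ = δ ^ 2 := by rw [norm_pow, norm_exp_eq, h1, Real.exp_log hδ]
    have h3 := (abs_le.1 (Complex.abs_re_le_norm (Complex.exp w ^ 2))).1
    linarith
  · have := re_exp_sq_nonneg h1 (hw.2.1.trans hψ')
    have := sq_nonneg δ
    linarith

lemma zetaSymbol_ne_zero {h : ℝ} {s : ℂ} (hs : 1 < (s ^ 2 + h).re) : zetaSymbol h s ≠ 0 :=
  riemannZeta_ne_zero_of_one_le_re hs.le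

lemma differentiableAt_zetaSymbol {h : ℝ} {s : ℂ} (hs : 1 < (s ^ 2 + h).re) :
    DifferentiableAt ℂ (zetaSymbol h) s := by
  have hne : s ^ 2 + h ≠ 1 := fun h1 => by
    rw [h1, Complex.one_re] at hs
    exact lt_irrefl _ hs
  exact (differentiableAt_riemannZeta hne).comp s
    (f := fun s : ℂ => s ^ 2 + (h : ℂ)) (by fun_prop)

lemma one_lt_sub_sq {h δ : ℝ} (hδ : 0 < δ) (hδ' : δ < Real.sqrt (h - 1)) : 1 < h - δ ^ 2 := by
  have := (Real.lt_sqrt hδ.le).1 hδ'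
  linarith

lemma solKernel_eq (h : ℝ) (F : ℂ → ℂ) (z : ℂ) :
    solKernel h F z = expKernel (fun w => F w / zetaSymbol h (Complex.exp w)) z := by
  ext w
  rw [solKernel, expKernel, mul_div_assoc]

/-- The coefficient `L(g)(s) / ζ(s² + h)` is continuous and bounded on the contours. -/
lemma IsSource.exists_isCoeff_div {g : ℝ → ℂ} {h δ ψ : ℝ} {F : ℂ → ℂ} (hg : IsSource g δ ψ F)
    (hψ' : ψ ≤ Real.pi) (hδ : 0 < δ) (hδ' : δ < Real.sqrt (h - 1)) :
    ∃ M : ℝ, IsCoeff δ ψ M (fun w => F w / zetaSymbol h (Complex.exp w)) := by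
  obtain ⟨M, hM⟩ := hg.exists_isCoeff
  have h1 := one_lt_sub_sq hδ hδ'
  obtain ⟨B, hB⟩ := exists_norm_inv_riemannZeta_le h1
  have hre : ∀ w ∈ coeffRegion δ ψ, 1 < (Complex.exp w ^ 2 + h).re := fun w hw =>
    h1.trans_le (re_symbol_ge hψ' hδ hw)
  refine ⟨M * B, hM.continuousOn.div (fun w hw => ?_) fun w hw => zetaSymbol_ne_zero (hre w hw),
    fun w hw => ?_⟩
  · exact ((differentiableAt_zetaSymbol (hre w hw)).continuousAt.comp
      Complex.continuous_exp.continuousAt).continuousWithinAt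
  · rw [div_eq_mul_inv, norm_mul]
    exact mul_le_mul (hM.bound w hw) (hB _ (re_symbol_ge hψ' hδ hw)) (norm_nonneg _)
      ((norm_nonneg _).trans (hM.bound w hw))

lemma ActsAs.memExp {K Ω : Set ℂ} {γ : ℝ → ℂ} {k φ u : ℂ → ℂ} (H : ActsAs K γ k φ u)
    (hK : K ⊆ Ω) : MemExp Ω φ := by
  obtain ⟨B, b, d, ⟨C, τ, -, -, e⟩, -⟩ := H
  exact ⟨d, ⟨C, τ, e⟩, K, B, hK, b⟩

lemma ActsAs.symbolEq {K Ω : Set ℂ} {γ : ℝ → ℂ} {k φ u : ℂ → ℂ} (H : ActsAs K γ k φ u)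
    (hK : K ⊆ Ω) (hγ : IsEnclosingCurve Ω K γ) : SymbolEq Ω k φ u := by
  refine ⟨H.memExp hK, ?_⟩
  obtain ⟨B, b, -, -, i⟩ := H
  refine ⟨K, B, γ, hK, b, hγ, fun z => ?_⟩
  rw [(i z).2, inv_mul_cancel_left₀ Complex.two_pi_I_ne_zero]

lemma IsEnclosingCurve.mono {Ω Ω' K : Set ℂ} {γ : ℝ → ℂ} (hγ : IsEnclosingCurve Ω K γ)
    (h : Ω ⊆ Ω') : IsEnclosingCurve Ω' K γ :=
  ⟨hγ.rectifiable, hγ.closed, hγ.simple, fun t ht => ⟨h (hγ.subset t ht).1, (hγ.subset t ht).2⟩,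
    hγ.winding⟩

/-- The truncated equation. -/
lemma IsSource.symbolEq_trunc {g : ℝ → ℂ} {h δ ψ : ℝ} {F : ℂ → ℂ} (hg : IsSource g δ ψ F)
    (hh : 1 < h) (hψ : 3 * Real.pi / 4 < ψ) (hψ' : ψ ≤ Real.pi) (hδ : 0 < δ)
    (hδ' : δ < Real.sqrt (h - 1)) {r : ℝ} (hr : δ < r) {Ω : Set ℂ}
    (hΩ : leftAngularDomain h ⊆ Ω) :
    MemExp Ω (fTrunc h δ ψ F r) ∧ MemExp Ω (gTrunc δ ψ F r) ∧
      SymbolEq Ω (zetaSymbol h) (fTrunc h δ ψ F r) (gTrunc δ ψ F r) := by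
  have hψ0 : 0 < ψ := lt_trans (by positivity) hψ
  obtain ⟨M, hM⟩ := hg.exists_isCoeff
  obtain ⟨M', hM'⟩ := hg.exists_isCoeff_div (h := h) hψ' hδ hδ'
  -- The curve is built in the smaller left angular domain, so it serves every `Ω` containing that
  -- domain.
  obtain ⟨γ, hγ, hγK, hCauchy⟩ := exists_enclosingCurve r hψ hψ' hδ hδ'
  have hk := differentiableOn_zetaSymbol hh
  have hK : contourSet δ ψ r ⊆ Ω := (contourSet_subset hψ hψ' hδ hδ').trans hΩ
  have A1 := hM'.actsAs hδ hψ hr hγ hγK hk hCauchy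
  have A2 := hM.actsAs hδ hψ hr hγ hγK hk hCauchy
  have e1 : (fun z => truncatedIntegral δ ψ r
      (expKernel (fun w => F w / zetaSymbol h (Complex.exp w)) z)) = fTrunc h δ ψ F r := by
    ext z
    rw [fTrunc, solKernel_eq]
  have e2 : (fun z => truncatedIntegral δ ψ r (expKernel (fun w => zetaSymbol h (Complex.exp w) *
      (F w / zetaSymbol h (Complex.exp w))) z)) = gTrunc δ ψ F r := by
    ext z
    -- On the trace of the contour the symbol does not vanish, so multiplication by it cancels the
    -- division.
    refine truncatedIntegral_congr hδ hψ0 hr fun w hw => ?_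
    have hw' : w ∈ coeffRegion δ ψ :=
      ⟨hw.1, hw.2.2.1, hw.2.2.2.imp id fun h1 => by rw [h1]; exact hψ.le⟩
    have hne := zetaSymbol_ne_zero ((one_lt_sub_sq hδ hδ').trans_le (re_symbol_ge hψ' hδ hw'))
    rw [expKernel, dataKernel, mul_div_cancel₀ _ hne]
  rw [e1, e2] at A1
  exact ⟨A1.memExp hK, A2.memExp hK, A1.symbolEq hK (hγK.mono hΩ)⟩

end ZetaNonlocal

end

/-! ### Assembly of the main theorem. -/

open ZetaNonlocal in
theorem mainTheorem7 (h : ℝ) (hh : 1 < h) (ψ δ : ℝ)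
    (hψ : 3 * Real.pi / 4 < ψ) (hψ' : ψ ≤ Real.pi)
    (hδ : 0 < δ) (hδ' : δ < Real.sqrt (h - 1))
    (g : ℝ → ℂ) (F : ℂ → ℂ) (hg : IsSource g δ ψ F) :
    -- the two contour integrals converge absolutely and define analytic functions on the region
    (∀ z ∈ angularRegion ψ, AngularIntegrable δ ψ (solKernel h F z) ∧
      AngularIntegrable δ ψ (dataKernel F z)) ∧
    AnalyticOnNhd ℂ (fInfty h δ ψ F) (angularRegion ψ) ∧
    AnalyticOnNhd ℂ (gInfty δ ψ F) (angularRegion ψ) ∧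
    -- the truncated functions solve the truncated equations
    (∀ r > δ, ∀ Ω ∈ ({slitDomain h, leftAngularDomain h} : Set (Set ℂ)),
      MemExp Ω (fTrunc h δ ψ F r) ∧ MemExp Ω (gTrunc δ ψ F r) ∧
      SymbolEq Ω (zetaSymbol h) (fTrunc h δ ψ F r) (gTrunc δ ψ F r)) ∧
    -- uniform limits on compact sets
    CompactConv (fTrunc h δ ψ F) (fInfty h δ ψ F) (angularRegion ψ) ∧
    CompactConv (gTrunc δ ψ F) (gInfty δ ψ F) (angularRegion ψ) ∧
    -- the contour integral lies in the solution set, and agrees with every other element of it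
    fInfty h δ ψ F ∈ solutionSet h δ ψ F ∧
    (∀ ψ' ∈ Ioc (3 * Real.pi / 4) ψ,
      EqOn (fInfty h δ ψ' F) (fInfty h δ ψ F) (angularRegion ψ')) ∧
    -- it solves the reinterpreted equation, whose right-hand side extends the source
    IsZetaTilde h δ ψ F (fInfty h δ ψ F) (gInfty δ ψ F) ∧
    (∀ G : ℂ → ℂ, IsZetaTilde h δ ψ F (fInfty h δ ψ F) G →
      EqOn G (gInfty δ ψ F) (angularRegion ψ) ∧ ∀ t : ℝ, 0 < t → G t = g t) ∧
    (∀ t : ℝ, 0 < t → gInfty δ ψ F t = g t) := by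
  obtain ⟨M, hM⟩ := hg.exists_isCoeff
  obtain ⟨M', hM'⟩ := hg.exists_isCoeff_div (h := h) hψ' hδ hδ'
  have hf : ∀ ψ' : ℝ, fInfty h δ ψ' F = fun z => angularIntegral δ ψ'
      (expKernel (fun w => F w / zetaSymbol h (Complex.exp w)) z) := fun ψ' => by
    ext z
    rw [fInfty, solKernel_eq]
  have hft : fTrunc h δ ψ F = fun r z => truncatedIntegral δ ψ r
      (expKernel (fun w => F w / zetaSymbol h (Complex.exp w)) z) := by
    ext r z
    rw [fTrunc, solKernel_eq]
  have hopen := isOpen_angularRegion hψ hψ'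
  have cf : CompactConv (fTrunc h δ ψ F) (fInfty h δ ψ F) (angularRegion ψ) := by
    rw [hf, hft]
    exact hM'.compactConv hδ hψ hψ'
  have cg : CompactConv (gTrunc δ ψ F) (gInfty δ ψ F) (angularRegion ψ) :=
    hM.compactConv hδ hψ hψ'
  have hgt : ∀ t : ℝ, 0 < t → gInfty δ ψ F t = g t := fun t ht => hg.gInfty_eq hδ hψ hψ' ht
  have hψpos : 0 < 3 * Real.pi / 4 := by positivity
  refine ⟨fun z hz => ⟨?_, hM.angularIntegrable hδ hψ hψ' hz⟩, ?_, ?_, ?_, cf, cg,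
    ⟨ψ, ⟨hψ, le_rfl⟩, rfl⟩, ?_, ?_, ?_, hgt⟩
  · rw [solKernel_eq]
    exact hM'.angularIntegrable hδ hψ hψ' hz
  · rw [hf]
    exact (hM'.differentiableOn_angularIntegral hδ hψ hψ').analyticOnNhd hopen
  · exact (hM.differentiableOn_angularIntegral hδ hψ hψ').analyticOnNhd hopen
  · rintro r hr Ω (rfl | rfl)
    · exact hg.symbolEq_trunc hh hψ hψ' hδ hδ' hr leftAngularDomain_subset_slitDomain
    · exact hg.symbolEq_trunc hh hψ hψ' hδ hδ' hr subset_rfl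
  · intro ψ' hψ'' z hz
    rw [hf, hf]
    refine hM'.angularIntegral_eq_of_le (DifferentiableOn.div ?_ ?_ ?_) hδ hψ''.1 hψ''.2 hψ' hz
    · exact hg.differentiableOn.mono fun w hw => ⟨hw.1, hw.2.2⟩
    all_goals
      intro w hw
      have hw' : w ∈ coeffRegion δ ψ := ⟨hw.1.le, hw.2.2.le, Or.inr hw.2.1.le⟩
      have h1 := (one_lt_sub_sq hδ hδ').trans_le (re_symbol_ge (h := h) hψ' hδ hw')
    · exact ((differentiableAt_zetaSymbol h1).comp w
        Complex.differentiable_exp.differentiableAt).differentiableWithinAt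
    · exact zetaSymbol_ne_zero h1
  · exact ⟨fTrunc h δ ψ F, gTrunc δ ψ F, fun r hr =>
      ⟨(hg.symbolEq_trunc hh hψ hψ' hδ hδ' hr subset_rfl).2.2, rfl⟩, cf, cg⟩
  -- Whatever the approximating family `φ`, the images `u r` are forced to be `gTrunc δ ψ F r`, so
  -- uniqueness of limits determines `G` on the region.
  · rintro G ⟨φ, u, hu, -, hG⟩
    have heq : EqOn G (gInfty δ ψ F) (angularRegion ψ) := by
      intro z hz
      refine tendsto_nhds_unique (hG.tendsto hz) ((cg.tendsto hz).congr' ?_)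
      filter_upwards [eventually_gt_atTop δ] with r hr
      rw [(hu r hr).2]
    exact ⟨heq, fun t ht => (heq (IsSource.ofReal_mem_angularRegion hψ ht)).trans (hgt t ht)⟩
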